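/- **Setting.** Let $n\ge 2$, let $(\bar M,g)$ be a compact smooth Riemannian manifold of dimension $n$ with boundary $\partial M$ and interior $M$, let $T>0$, $M_T=M\times(0,T]$, $\bar M_T=\bar M\times[0,T]$, and let $\mathcal P M_T=(M\times\{0\})\cup(\partial M\times[0,T])$ be the parabolic boundary. Write $\nabla u,\nabla^2u$ for the differential and the Riemannian Hessian in $x\in \bar M$. Let $\Gamma\subset\mathbb R^{n+1}$ be an open, convex, symmetric cone with vertex at the origin, $\Gamma\ne\mathbb R^{n+1}$, containing $\{\lambda:\lambda_i>0\ \forall i\}$, and let $f\in C^\infty(\Gamma)\cap C^0(\bar\Gamma)$ be symmetric with $\partial f/\partial\lambda_i>0$ in $\Gamma$ for $1\le i\le n+1$ and $f$ concave in $\Gamma$. Assume that for every $C>0$ there is $R>0$ with $f(R,\dots,R)>C$ (i.e. $f(R\cdot\mathbf 1)\to\infty$ as $R\to\infty$). Let $A(x,t,p)$, for $(x,p)\in T^*\bar M$, $t\in[0,T]$, be a smooth family of symmetric bilinear forms on $T_x\bar M$ such that $-A$ is regular: $-\sum A^{ij}_{p_kp_l}(x,t,p)\xi_i\xi_j\eta_k\eta_l\ge0$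 for all $x,t,p$ and all $\xi,\eta$ with $g(\xi,\eta)=0$. Let $\psi\in C^\infty(T^*\bar M\times[0,T])$ be such that $\psi(x,t,p)$ is convex in $p$. Put $A[u]=A(x,t,\nabla u)$, $\psi[u]=\psi(x,t,\nabla u)$, and let $\lambda(\cdot)$ denote the eigenvalues with respect to $g$. A function $u$ is admissible if $(\lambda(\nabla^2u+A[u]),-u_t)\in\Gamma$ in $M\times[0,T]$. Let $\varphi$ be a function on $\mathcal{P}M_T$ and assume that there is an admissible $\underline u\in C^2(\bar M_T)$ with $$f(\lambda(\nabla^2\underline u+A[\underline u]),-\underline u_t)\ge\psi[\underline u]\ \text{ in }M\times[0,T],\qquad \underline u=\varphi\ \text{ on }\partial M\times[0,T],\qquad \underline u\le\varphi\ \text{ on }M\times\{0\},$$ and that $(\lambda(\nabla^2\underline u+A[\underline u]),-\underline u_t)$ takes its values on $M\times[0,T]$ in a compact set $\mathcal K\subset\Gamma$. **Theorem.** Let $u\in C^3(\bar M_T)$ be an admissible solution of $$f(\lambda(\nabla^2u+A[u]),-u_t)=\psi[u]\ \text{ in }M_T,\qquad u=\varphi\ \text{ on }\mathcal P M_T .$$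 Then $$\sup_{\bar M_T}|u_t|\le C_4\Bigl(1+\sup_{\mathcal P M_T}|u_t|\Bigr),$$ where $C_4>0$ depends only on $n,\bar M,g,T,\Gamma,f,A,\mathcal K$ and on a common upper bound $B$ for $\sup_{\bar M_T}(|u|+|\nabla u|)$, for $\sup_{\bar M_T}(|\underline u|+|\nabla\underline u|+|\nabla^2\underline u|+|\underline u_t|)$, and for the $C^2$ norm of $\psi$ on $\{(x,t,p):|p|\le B\}$ (measured in a fixed finite atlas). In particular $C_4$ does not depend on $\varphi$, nor on $u$, $\underline u$, $\psi$ otherwise. -/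

import Mathlib

open Set Filter Topology
open scoped Manifold ContDiff

noncomputable section

namespace AugHess

/-! ### Tangent and cotangent spaces, metric, first and second derivatives

The closed manifold with boundary is the type `M`, modelled on the Euclidean half space; its
interior and boundary are `(𝓡∂ n).interior M` and `(𝓡∂ n).boundary M`. -/

/-- The model vector space. -/
abbrev EE (n : ℕ) : Type := EuclideanSpace ℝ (Fin n)

/-- Cotangent space at `x`. -/
abbrev Cot (n : ℕ) [NeZero n] {M : Type*} [TopologicalSpace M]
    [ChartedSpace (EuclideanHalfSpace n) M] (x : M) : Type :=
  TangentSpace (𝓡∂ n) x →L[ℝ] ℝ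

/-- Bilinear forms on the tangent space at `x`. -/
abbrev Form (n : ℕ) [NeZero n] {M : Type*} [TopologicalSpace M]
    [ChartedSpace (EuclideanHalfSpace n) M] (x : M) : Type :=
  LinearMap.BilinForm ℝ (TangentSpace (𝓡∂ n) x)

/-- Smooth Riemannian metrics on `M`. -/
abbrev Metric (n : ℕ) [NeZero n] (M : Type*) [TopologicalSpace M]
    [ChartedSpace (EuclideanHalfSpace n) M] [IsManifold (𝓡∂ n) ∞ M] : Type _ :=
  Bundle.ContMDiffRiemannianMetric (𝓡∂ n) ∞ (EE n) (fun x : M => TangentSpace (𝓡∂ n) x)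

section Geometry

variable {n : ℕ} [NeZero n] {M : Type*} [TopologicalSpace M]
  [ChartedSpace (EuclideanHalfSpace n) M]

/-- The spatial differential `∇u (x, t)`, as a covector (one-sided at boundary points). -/
def du (n : ℕ) [NeZero n] {M : Type*} [TopologicalSpace M]
    [ChartedSpace (EuclideanHalfSpace n) M] (u : M → ℝ → ℝ) (x : M) (t : ℝ) : Cot n x :=
  mfderiv (𝓡∂ n) 𝓘(ℝ, ℝ) (fun y => u y t) x

/-- The time derivative `u_t (x, t)` on `[0, T]` (one-sided at the end points). -/
def ut {M : Type*} (T : ℝ) (u : M → ℝ → ℝ) (x : M) (t : ℝ) : ℝ :=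
  derivWithin (fun s => u x s) (Icc 0 T) t

/-- `u ∈ C^k (M̄ × [0, T])`, jointly in space and time. -/
def IsCk (n : ℕ) [NeZero n] {M : Type*} [TopologicalSpace M]
    [ChartedSpace (EuclideanHalfSpace n) M] (k : ℕ) (T : ℝ) (u : M → ℝ → ℝ) : Prop :=
  ContMDiffOn ((𝓡∂ n).prod 𝓘(ℝ, ℝ)) 𝓘(ℝ, ℝ) (k : WithTop ℕ∞)
    (fun q : M × ℝ => u q.1 q.2) (univ ×ˢ Icc 0 T)

variable [IsManifold (𝓡∂ n) ∞ M]

/-- The differential at `z` of the chart centred at `c` (for `z` in its source). -/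
def chartD (n : ℕ) [NeZero n] {M : Type*} [TopologicalSpace M]
    [ChartedSpace (EuclideanHalfSpace n) M] [IsManifold (𝓡∂ n) ∞ M] (c z : M) :
    TangentSpace (𝓡∂ n) z →L[ℝ] EE n :=
  (trivializationAt (EE n) (TangentSpace (𝓡∂ n)) c).continuousLinearMapAt ℝ z

/-- The inverse of `chartD n c z` (for `z` in the source of the chart centred at `c`). -/
def chartDinv (n : ℕ) [NeZero n] {M : Type*} [TopologicalSpace M]
    [ChartedSpace (EuclideanHalfSpace n) M] [IsManifold (𝓡∂ n) ∞ M] (c z : M) :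
    EE n →L[ℝ] TangentSpace (𝓡∂ n) z :=
  (trivializationAt (EE n) (TangentSpace (𝓡∂ n)) c).symmL ℝ z

/-- The matrix `g_{ij} (y)` of the metric in the chart centred at `c`, as a bilinear form. -/
def chartMetric (g : Metric n M) (c : M) (y : EE n) : EE n →L[ℝ] EE n →L[ℝ] ℝ :=
  let z := (extChartAt (𝓡∂ n) c).symm y
  ((chartDinv n c z).precomp ℝ).comp ((g.inner z).comp (chartDinv n c z))

/-- `∂_i g_{jk}` at `x` in the chart centred at `x`. -/
def dMetric (g : Metric n M) (x : M) : EE n →L[ℝ] EE n →L[ℝ] EE n →L[ℝ] ℝ :=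
  fderivWithin ℝ (chartMetric g x) (range (𝓡∂ n)) (extChartAt (𝓡∂ n) x x)

/-- Index raising is well defined. -/
theorem exists_sharp (g : Metric n M) (x : M) (p : TangentSpace (𝓡∂ n) x →ₗ[ℝ] ℝ) :
    ∃ v : TangentSpace (𝓡∂ n) x, ∀ w, g.inner x v w = p w := by
  let L : TangentSpace (𝓡∂ n) x →ₗ[ℝ] Module.Dual ℝ (TangentSpace (𝓡∂ n) x) :=
    LinearMap.mk₂ ℝ (fun v w => g.inner x v w) (by simp) (by simp) (by simp) (by simp)
  have : FiniteDimensional ℝ (TangentSpace (𝓡∂ n) x) :=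
    inferInstanceAs (FiniteDimensional ℝ (EE n))
  have hinj : Function.Injective L := by
    rw [injective_iff_map_eq_zero]
    intro v hv
    by_contra hne
    have h1 := g.pos x v hne
    have h2 : L v v = 0 := by rw [hv]; rfl
    exact h1.ne' h2
  have hsurj : Function.Surjective L :=
    (LinearMap.injective_iff_surjective_of_finrank_eq_finrank
      (Subspace.dual_finrank_eq (K := ℝ) (V := TangentSpace (𝓡∂ n) x)).symm).1 hinj
  obtain ⟨v, hv⟩ := hsurj p
  exact ⟨v, fun w => LinearMap.congr_fun hv w⟩

/-- The vector dual to the covector `p`. -/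
def sharp (g : Metric n M) (x : M) (p : Cot n x) : TangentSpace (𝓡∂ n) x :=
  (exists_sharp g x p.toLinearMap).choose

/-- `|p|` for a covector `p`. -/
def covNorm (g : Metric n M) (x : M) (p : Cot n x) : ℝ :=
  Real.sqrt (g.inner x (sharp g x p) (sharp g x p))

/-- Second coordinate derivatives `∂_{ij} u` at `x` in the chart centred at `x`. -/
def coordD2 (n : ℕ) [NeZero n] {M : Type*} [TopologicalSpace M]
    [ChartedSpace (EuclideanHalfSpace n) M] (w : M → ℝ) (x : M) : EE n →L[ℝ] EE n →L[ℝ] ℝ :=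
  fderivWithin ℝ
    (fun y => fderivWithin ℝ (w ∘ (extChartAt (𝓡∂ n) x).symm) (range (𝓡∂ n)) y)
    (range (𝓡∂ n)) (extChartAt (𝓡∂ n) x x)

/-- `Γ_{ij}^k ∂_k u` at `x` in the chart centred at `x`, with the Christoffel symbols of the
Levi-Civita connection: if `X = grad u`, it is
`(∂_i g_{jk} + ∂_j g_{ik} - ∂_k g_{ij}) X^k / 2`. -/
def christoffelTerm (g : Metric n M) (x : M) (X : EE n) : LinearMap.BilinForm ℝ (EE n) :=
  LinearMap.mk₂ ℝ
    (fun v w => (dMetric g x v w X + dMetric g x w v X - dMetric g x X v w) / 2)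
    (by intros; simp; ring) (by intros; simp; ring)
    (by intros; simp; ring) (by intros; simp; ring)

/-- The Riemannian Hessian `∇² u (x, t)`: in the chart centred at `x` it is
`∂_{ij} u - Γ_{ij}^k ∂_k u`. (The tangent space at `x` is identified with the model space
through the chart centred at `x`.) -/
def hess (g : Metric n M) (u : M → ℝ → ℝ) (x : M) (t : ℝ) : Form n x :=
  (LinearMap.mk₂ ℝ (fun v w : EE n => coordD2 n (fun y => u y t) x v w)
    (by simp) (by simp) (by simp) (by simp) : LinearMap.BilinForm ℝ (EE n)) -
  christoffelTerm g x (sharp g x (du n u x t))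

/-! ### Eigenvalues with respect to the metric -/

/-- `l` lists the eigenvalues, with multiplicity, of the form `U` with respect to `g`. -/
def IsEigenvalues (g : Metric n M) (x : M) (U : Form n x) (l : Fin n → ℝ) : Prop :=
  ∃ e : Module.Basis (Fin n) ℝ (TangentSpace (𝓡∂ n) x),
    (∀ i j, g.inner x (e i) (e j) = if i = j then 1 else 0) ∧
    ∀ i j, U (e i) (e j) = if i = j then l i else 0

/-- A symmetric form is diagonal in some orthonormal basis. -/
theorem exists_isEigenvalues (g : Metric n M) (x : M) (U : Form n x)
    (hU : ∀ v w, U v w = U w v) : ∃ l, IsEigenvalues g x U l := by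
  have : FiniteDimensional ℝ (TangentSpace (𝓡∂ n) x) :=
    inferInstanceAs (FiniteDimensional ℝ (EE n))
  have hfr : Module.finrank ℝ (TangentSpace (𝓡∂ n) x) = n :=
    finrank_euclideanSpace_fin (𝕜 := ℝ) (n := n)
  let core : InnerProductSpace.Core ℝ (TangentSpace (𝓡∂ n) x) :=
    { inner := fun v w => g.inner x v w
      conj_inner_symm := fun v w => by simpa using g.symm x w v
      re_inner_nonneg := fun v => by
        by_cases hv : v = 0
        · simp [hv]
        · simpa using (g.pos x v hv).le
      add_left := by simp
      smul_left := by simp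
      definite := fun v hv => by
        by_contra hne
        exact (g.pos x v hne).ne' hv }
  letI : NormedAddCommGroup (TangentSpace (𝓡∂ n) x) := core.toNormedAddCommGroup
  letI : InnerProductSpace ℝ (TangentSpace (𝓡∂ n) x) := InnerProductSpace.ofCore core.toCore
  have hin : ∀ v w : TangentSpace (𝓡∂ n) x, inner ℝ v w = g.inner x v w := fun _ _ => rfl
  choose S hS using fun v : TangentSpace (𝓡∂ n) x =>
    exists_sharp g x (U v)
  have hS' : ∀ v w, inner ℝ (S v) w = U v w := fun v w => hS v w
  let L : TangentSpace (𝓡∂ n) x →ₗ[ℝ] TangentSpace (𝓡∂ n) x :=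
    { toFun := S
      map_add' := fun v w => ext_inner_right ℝ fun z => by
        rw [inner_add_left, hS', hS', hS']; simp
      map_smul' := fun r v => ext_inner_right ℝ fun z => by
        rw [RingHom.id_apply, real_inner_smul_left, hS', hS']; simp }
  have hL : L.IsSymmetric := fun v w => by
    rw [real_inner_comm (L w) v]
    exact (hS' v w).trans ((hU v w).trans (hS' w v).symm)
  let b := hL.eigenvectorBasis hfr
  refine ⟨hL.eigenvalues hfr, b.toBasis, fun i j => ?_, fun i j => ?_⟩
  · rw [← hin]
    simpa using orthonormal_iff_ite.1 b.orthonormal i j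
  · rw [← hS']
    have h1 : S (b.toBasis i) = hL.eigenvalues hfr i • b i := by
      rw [OrthonormalBasis.coe_toBasis]
      exact hL.apply_eigenvectorBasis hfr i
    rw [h1, real_inner_smul_left]
    have h2 := orthonormal_iff_ite.1 b.orthonormal i j
    simp only [OrthonormalBasis.coe_toBasis, h2]
    split_ifs <;> simp

open Classical in
/-- `λ(U)`, the eigenvalues of a symmetric form `U` with respect to `g`, in some order. -/
def eigs (g : Metric n M) (x : M) (U : Form n x) : Fin n → ℝ :=
  if h : ∃ l, IsEigenvalues g x U l then h.choose else 0

end Geometry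

/-! ### The data of the problem -/

/-- The cone `Γ` and the function `f`: an open convex symmetric proper subcone of `ℝ^{n+1}` with
vertex at the origin that contains the positive cone, and a symmetric function on it, smooth,
continuous up to the boundary, with positive partial derivatives, and concave. -/
structure IsStructure {N : ℕ} (Γ : Set (Fin N → ℝ)) (f : (Fin N → ℝ) → ℝ) : Prop where
  isOpen : IsOpen Γ
  convex : Convex ℝ Γ
  cone : ∀ r : ℝ, 0 < r → ∀ l ∈ Γ, r • l ∈ Γ
  symm : ∀ σ : Equiv.Perm (Fin N), ∀ l ∈ Γ, l ∘ σ ∈ Γ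
  proper : Γ ≠ univ
  pos_subset : {l | ∀ i, 0 < l i} ⊆ Γ
  f_symm : ∀ σ : Equiv.Perm (Fin N), ∀ l ∈ Γ, f (l ∘ σ) = f l
  f_smooth : ContDiffOn ℝ ∞ f Γ
  f_cont : ContinuousOn f (closure Γ)
  f_mono : ∀ l ∈ Γ, ∀ i, 0 < fderiv ℝ f l (Pi.single i 1)
  f_concave : ConcaveOn ℝ Γ f

section Data

variable {n : ℕ} [NeZero n] {M : Type*} [TopologicalSpace M]
  [ChartedSpace (EuclideanHalfSpace n) M] [IsManifold (𝓡∂ n) ∞ M]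

/-- Coordinate domain of `T*M̄ × [0, T]` over the chart centred at `c`. -/
def coordDom (n : ℕ) [NeZero n] {M : Type*} [TopologicalSpace M]
    [ChartedSpace (EuclideanHalfSpace n) M] (T : ℝ) (c : M) : Set (EE n × ℝ × (EE n →L[ℝ] ℝ)) :=
  (extChartAt (𝓡∂ n) c).target ×ˢ Icc 0 T ×ˢ univ

/-- The function `ψ (x, t, p)` in the coordinates of `T*M̄ × [0, T]` over the chart at `c`. -/
def coordFun (ψ : (x : M) → ℝ → Cot n x → ℝ) (c : M) (q : EE n × ℝ × (EE n →L[ℝ] ℝ)) : ℝ :=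
  let z := (extChartAt (𝓡∂ n) c).symm q.1
  ψ z q.2.1 (q.2.2.comp (chartD n c z))

/-- `ψ ∈ C^∞ (T*M̄ × [0, T])`. -/
def IsSmoothFun (T : ℝ) (ψ : (x : M) → ℝ → Cot n x → ℝ) : Prop :=
  ∀ c : M, ContDiffOn ℝ ∞ (coordFun ψ c) (coordDom n T c)

/-- The `(0,2)` tensor `A (x, t, p)` is smooth on `T*M̄ × [0, T]`: all its components in the
coordinates over each chart are smooth. -/
def IsSmoothTensor (T : ℝ) (A : (x : M) → ℝ → Cot n x → Form n x) : Prop :=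
  ∀ (c : M) (v w : EE n),
    ContDiffOn ℝ ∞
      (coordFun (fun x t p => A x t p (chartDinv n c x v) (chartDinv n c x w)) c)
      (coordDom n T c)

/-- `B` is regular: `B^{ij}_{p_k p_l} ξ_i ξ_j η_k η_l ≥ 0` whenever `ξ ⊥ η`. Here `ξ` is a tangent
vector and `η` a covector, so that orthogonality is `η ξ = 0`, and the sum over `k, l` is the
second derivative in `p` in the direction `η`. -/
def IsRegular (T : ℝ) (B : (x : M) → ℝ → Cot n x → Form n x) : Prop :=
  ∀ x : M, ∀ t ∈ Icc 0 T, ∀ p η : Cot n x, ∀ ξ : TangentSpace (𝓡∂ n) x, η ξ = 0 →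
    0 ≤ iteratedDeriv 2 (fun s : ℝ => B x t (p + s • η) ξ ξ) 0

/-- A finite cover of `M̄` by compact subsets of chart domains, used to measure `C^k` norms. -/
structure FiniteAtlas (n : ℕ) [NeZero n] (M : Type*) [TopologicalSpace M]
    [ChartedSpace (EuclideanHalfSpace n) M] where
  centers : Finset M
  piece : M → Set M
  isCompact : ∀ c ∈ centers, IsCompact (piece c)
  subset_source : ∀ c ∈ centers, piece c ⊆ (chartAt (EuclideanHalfSpace n) c).source
  covers : ∀ x : M, ∃ c ∈ centers, x ∈ piece c

/-- `|ψ|_{C²} ≤ B` over `{|p| ≤ B}`, with the `C²` norm measured in the atlas `𝒜`. -/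
def C2Bound (𝒜 : FiniteAtlas n M) (g : Metric n M) (T B : ℝ)
    (ψ : (x : M) → ℝ → Cot n x → ℝ) : Prop :=
  ∀ c ∈ 𝒜.centers, ∀ x ∈ 𝒜.piece c, ∀ t ∈ Icc 0 T, ∀ p : Cot n x, covNorm g x p ≤ B →
    ∀ k ≤ 2, ‖iteratedFDerivWithin ℝ k (coordFun ψ c) (coordDom n T c)
      (extChartAt (𝓡∂ n) c x, t, p.comp (chartDinv n c x))‖ ≤ B

/-- `|u| + |∇u| ≤ B` on `M̄ × [0, T]`. -/
def SpaceC1Bound (g : Metric n M) (T B : ℝ) (u : M → ℝ → ℝ) : Prop :=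
  ∀ x : M, ∀ t ∈ Icc 0 T, |u x t| + covNorm g x (du n u x t) ≤ B

/-- `|u| + |∇u| + |∇²u| + |u_t| ≤ B` on `M̄ × [0, T]`, where `|∇²u|` is the operator norm of the
Hessian, the largest absolute value of its eigenvalues. -/
def ParabolicC2Bound (g : Metric n M) (T B : ℝ) (u : M → ℝ → ℝ) : Prop :=
  ∀ x : M, ∀ t ∈ Icc 0 T, ∀ i,
    |u x t| + covNorm g x (du n u x t) + |eigs g x (hess g u x t) i| + |ut T u x t| ≤ B

/-- The point `(λ(∇²u + A[u]), -u_t)` of `ℝ^{n+1}`. -/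
def spec (g : Metric n M) (T : ℝ) (A : (x : M) → ℝ → Cot n x → Form n x) (u : M → ℝ → ℝ)
    (x : M) (t : ℝ) : Fin (n + 1) → ℝ :=
  Fin.snoc (α := fun _ => ℝ) (eigs g x (hess g u x t + A x t (du n u x t))) (-ut T u x t)

/-- `u` is admissible: `(λ(∇²u + A[u]), -u_t) ∈ Γ` in `M × [0, T]`. -/
def IsAdmissible (g : Metric n M) (T : ℝ) (A : (x : M) → ℝ → Cot n x → Form n x)
    (Γ : Set (Fin (n + 1) → ℝ)) (u : M → ℝ → ℝ) : Prop :=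
  ∀ x ∈ (𝓡∂ n).interior M, ∀ t ∈ Icc 0 T, spec g T A u x t ∈ Γ

/-- The parabolic boundary `M × {0} ∪ ∂M × [0, T]`. -/
def parabolicBoundary (n : ℕ) [NeZero n] (M : Type*) [TopologicalSpace M]
    [ChartedSpace (EuclideanHalfSpace n) M] (T : ℝ) : Set (M × ℝ) :=
  ((𝓡∂ n).interior M ×ˢ {0}) ∪ ((𝓡∂ n).boundary M ×ˢ Icc 0 T)

/-- `u` is an admissible `C³` solution of the initial-boundary value problem
`f(λ(∇²u + A[u]), -u_t) = ψ[u]` in `M × (0, T]`, `u = φ` on the parabolic boundary. -/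
structure IsSolution (g : Metric n M) (T : ℝ) (A : (x : M) → ℝ → Cot n x → Form n x)
    (Γ : Set (Fin (n + 1) → ℝ)) (f : (Fin (n + 1) → ℝ) → ℝ)
    (ψ : (x : M) → ℝ → Cot n x → ℝ) (φ u : M → ℝ → ℝ) : Prop where
  isC3 : IsCk n 3 T u
  admissible : IsAdmissible g T A Γ u
  eqn : ∀ x ∈ (𝓡∂ n).interior M, ∀ t ∈ Ioc 0 T,
    f (spec g T A u x t) = ψ x t (du n u x t)
  bdry : ∀ q ∈ parabolicBoundary n M T, u q.1 q.2 = φ q.1 q.2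

/-- `v` is an admissible `C²` subsolution. -/
structure IsSubsolution (g : Metric n M) (T : ℝ) (A : (x : M) → ℝ → Cot n x → Form n x)
    (Γ : Set (Fin (n + 1) → ℝ)) (f : (Fin (n + 1) → ℝ) → ℝ)
    (ψ : (x : M) → ℝ → Cot n x → ℝ) (φ v : M → ℝ → ℝ) : Prop where
  isC2 : IsCk n 2 T v
  admissible : IsAdmissible g T A Γ v
  ineq : ∀ x ∈ (𝓡∂ n).interior M, ∀ t ∈ Icc 0 T,
    ψ x t (du n v x t) ≤ f (spec g T A v x t)
  lateral : ∀ x ∈ (𝓡∂ n).boundary M, ∀ t ∈ Icc 0 T, v x t = φ x t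
  initial : ∀ x ∈ (𝓡∂ n).interior M, v x 0 ≤ φ x 0

end Data

end AugHess

end

/-!
The estimate is a maximum principle argument for `W = σ u_t + a exp (k (v - u - t))` with `σ = ±1`
and `v` the subsolution. Write `F_i` for the derivatives `∂f/∂λ_i > 0` at the spectrum of the
solution and let `e_i` be an orthonormal frame that diagonalizes `∇²u + A[u]` at the point
considered. The term `-t` in the exponent is what makes a barrier out of a subsolution that need
not be strict: it raises the last argument `-v_t` of `f` by `1`. Over the compact set `K` this
raises `f` by a definite amount `c`, even after all arguments are lowered by a small `δ`
(`IsStructure.exists_gain`). As `f` is concave, and by Birkhoff's theorem does not decrease from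
the spectrum to the diagonal in an orthonormal frame (`IsStructure.le_mulVec`, `le_diagPt`),
`f` at the shifted diagonal of `v` can be compared with its tangent at the spectrum of `u`; as `ψ`
is convex in `p`, this gives `barrier_le`: with `ψ_p (v - u)` short for `ψ_p · (∇v - ∇u)`,
`ψ_p (v - u) + c ≤ ∑ F_i ((∇²v + A[v] - ∇²u - A[u])(e_i, e_i) - δ) + F_{n+1} (u_t - v_t + 1 - δ)`.

Suppose that `W` has a maximum at a point of the interior of `M` and a time in `(0, T)`, and put
`η = ∇v - ∇u` and `E = a k exp (k (v - u - t)) > 0`. Then `σ ∇u_t = -E η`, and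
`σ ∇²u_t + E (∇²v - ∇²u + k η ⊗ η) ≤ 0`, and `σ u_tt + E (v_t - u_t - 1) ≥ 0`
(`conditions_of_isMax`; the Christoffel terms cancel by the first condition). Insert these in the
time derivative of the equation (`IsSolution.time_derivative`) and add `E` times the barrier
inequality. What remains of `A` is the deviation of `A(x, t, ·)(e_i, e_i)` from its tangent.
Regularity says that this function is concave in the directions that annihilate `e_i`, so the
deviation is at most `2 C |η(e_i)|` (`regular_le`), which `k η(e_i)²` and half of `δ` absorb; the
other half of `δ` absorbs `A_t`, and `E c` exceeds `|ψ_t|`, once `a` is large. This is a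
contradiction (`not_isMax_of_interior`), so the maximum lies on the parabolic boundary, where
`|u_t|` is at most its supremum.

Derivatives of `u_t` at `t = T` are one-sided, so the argument is run on `[0, S]` with `S < T`, and
the estimate at `T` follows by continuity. Eigenvalues are not differentiable where they cross; the
time derivative of the equation is therefore taken along the diagonal in a fixed frame, by a
comparison that is an equality at the time in question.
-/

namespace AugHess

/-! ### Concave functions on the cone -/

theorem _root_.ConcaveOn.le_add_of_hasFDerivAt {E : Type*} [NormedAddCommGroup E]
    [NormedSpace ℝ E] {s : Set E} {f : E → ℝ} (hf : ConcaveOn ℝ s f) {x y : E} {f' : E →L[ℝ] ℝ}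
    (hx : x ∈ s) (hy : y ∈ s) (hd : HasFDerivAt f f' x) : f y ≤ f x + f' (y - x) := by
  have hline : HasDerivAt (AffineMap.lineMap x y : ℝ → E) (y - x) 0 := AffineMap.hasDerivAt_lineMap
  have h0 : (AffineMap.lineMap x y : ℝ → E) 0 = x := AffineMap.lineMap_apply_zero x y
  have h1 : HasDerivAt (f ∘ (AffineMap.lineMap x y : ℝ → E)) (f' (y - x)) 0 := by
    apply HasFDerivAt.comp_hasDerivAt
    · rw [h0]; exact hd
    · exact hline
  have h2 := (hf.comp_affineMap (AffineMap.lineMap x y)).slope_le_of_hasDerivAt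
    (x := 0) (y := 1) (by simpa using hx) (by simpa using hy) one_pos h1
  simp [slope] at h2
  rw [map_sub]
  linarith

theorem _root_.ConvexOn.add_le_of_hasFDerivAt {E : Type*} [NormedAddCommGroup E]
    [NormedSpace ℝ E] {s : Set E} {f : E → ℝ} (hf : ConvexOn ℝ s f) {x y : E} {f' : E →L[ℝ] ℝ}
    (hx : x ∈ s) (hy : y ∈ s) (hd : HasFDerivAt f f' x) : f x + f' (y - x) ≤ f y := by
  have := hf.neg.le_add_of_hasFDerivAt hx hy hd.neg
  simp at this
  rw [map_sub]
  linarith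

section Cone

variable {N : ℕ} {Γ : Set (Fin N → ℝ)} {f : (Fin N → ℝ) → ℝ}

theorem IsStructure.add_mem (h : IsStructure Γ f) {x y : Fin N → ℝ} (hx : x ∈ Γ) (hy : y ∈ Γ) :
    x + y ∈ Γ := by
  have := h.cone 2 two_pos _ (h.convex hx hy (by norm_num : (0 : ℝ) ≤ 1 / 2)
    (by norm_num : (0 : ℝ) ≤ 1 / 2) (by norm_num))
  rwa [← smul_add, smul_smul, show (2 : ℝ) * (1 / 2) = 1 by norm_num, one_smul] at this

theorem IsStructure.add_nonneg_mem (h : IsStructure Γ f) {x y : Fin N → ℝ} (hx : x ∈ Γ)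
    (hy : ∀ i, 0 ≤ y i) : x + y ∈ Γ := by
  have hc : Tendsto (fun s : ℝ => x - fun _ => s) (𝓝 0) (𝓝 x) := by
    have : Continuous fun s : ℝ => x - fun _ => s := by fun_prop
    simpa [← Pi.zero_def] using this.tendsto 0
  have hev := (hc.eventually (h.isOpen.mem_nhds hx)).filter_mono (nhdsWithin_le_nhds (s := Ioi 0))
  obtain ⟨s, hs, hs0⟩ := (hev.and self_mem_nhdsWithin).exists
  have : x + y = (x - fun _ => s) + (y + fun _ => s) := by abel
  rw [this]
  exact h.add_mem hs (h.pos_subset fun i => add_pos_of_nonneg_of_pos (hy i) hs0)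

theorem IsStructure.hasFDerivAt (h : IsStructure Γ f) {x : Fin N → ℝ} (hx : x ∈ Γ) :
    HasFDerivAt f (fderiv ℝ f x) x :=
  ((h.f_smooth.contDiffAt (h.isOpen.mem_nhds hx)).differentiableAt (by simp)).hasFDerivAt

theorem IsStructure.le_add_fderiv (h : IsStructure Γ f) {x y : Fin N → ℝ} (hx : x ∈ Γ)
    (hy : y ∈ Γ) : f y ≤ f x + fderiv ℝ f x (y - x) :=
  h.f_concave.le_add_of_hasFDerivAt hx hy (h.hasFDerivAt hx)

theorem fderiv_eq_sum (x v : Fin N → ℝ) :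
    fderiv ℝ f x v = ∑ i, v i * fderiv ℝ f x (Pi.single i 1) := by
  conv_lhs => rw [pi_eq_sum_univ' v]
  simp

theorem IsStructure.le_add_nonneg (h : IsStructure Γ f) {x y : Fin N → ℝ} (hx : x ∈ Γ)
    (hy : ∀ i, 0 ≤ y i) : f x ≤ f (x + y) := by
  have hxy := h.add_nonneg_mem hx hy
  have h1 := h.le_add_fderiv hxy hx
  have h2 : 0 ≤ fderiv ℝ f (x + y) y := by
    rw [fderiv_eq_sum]
    exact Finset.sum_nonneg fun i _ => mul_nonneg (hy i) (h.f_mono _ hxy i).le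
  have h3 : x - (x + y) = -y := by abel
  rw [h3, map_neg] at h1
  linarith

theorem IsStructure.lt_add_single (h : IsStructure Γ f) {x : Fin N → ℝ} (hx : x ∈ Γ)
    (i : Fin N) : f x < f (x + Pi.single i 1) := by
  have hxy := h.add_nonneg_mem hx (y := Pi.single i 1) fun j => by
    by_cases hj : j = i
    · subst hj; simp
    · simp [hj]
  have h1 := h.le_add_fderiv hxy hx
  have h2 := h.f_mono _ hxy i
  have h3 : x - (x + Pi.single i 1) = -Pi.single i 1 := by abel
  rw [h3, map_neg] at h1
  linarith

/-- Raising one coordinate by `1` gains a definite amount over a compact subset of `Γ`, even after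
all coordinates are lowered a little. This is all of the strictness that the maximum principle
uses: it gives a barrier no matter how the derivatives of `f` are distributed. -/
theorem IsStructure.exists_gain (h : IsStructure Γ f) {K : Set (Fin N → ℝ)} (hK : IsCompact K)
    (hKΓ : K ⊆ Γ) (i : Fin N) :
    ∃ c > 0, ∃ δ > 0, ∀ μ ∈ K, (μ + Pi.single i 1 - fun _ => δ) ∈ Γ ∧
      f μ + c ≤ f (μ + Pi.single i 1 - fun _ => δ) := by
  -- smaller constants are also admissible
  have shrink : ∀ {μ : Fin N → ℝ} {c c' δ δ' : ℝ}, c' ≤ c → δ' ≤ δ →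
      ((μ + Pi.single i 1 - fun _ => δ) ∈ Γ ∧ f μ + c ≤ f (μ + Pi.single i 1 - fun _ => δ)) →
      ((μ + Pi.single i 1 - fun _ => δ') ∈ Γ ∧
        f μ + c' ≤ f (μ + Pi.single i 1 - fun _ => δ')) := by
    intro μ c c' δ δ' hc hδ ⟨h1, h2⟩
    have h3 : (μ + Pi.single i 1 - fun _ => δ') =
        (μ + Pi.single i 1 - fun _ => δ) + fun _ => δ - δ' := by
      ext j; simp
    have h4 : ∀ j : Fin N, 0 ≤ (fun _ : Fin N => δ - δ') j := fun j => by simpa using hδ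
    rw [h3]
    exact ⟨h.add_nonneg_mem h1 h4, by linarith [h.le_add_nonneg h1 h4]⟩
  refine hK.induction_on (p := fun s => ∃ c > 0, ∃ δ > 0, ∀ μ ∈ s,
    (μ + Pi.single i 1 - fun _ => δ) ∈ Γ ∧ f μ + c ≤ f (μ + Pi.single i 1 - fun _ => δ))
    ⟨1, one_pos, 1, one_pos, by simp⟩ ?_ ?_ ?_
  · intro s t hst ih
    obtain ⟨c, hc, δ, hδ, H⟩ := ih
    exact ⟨c, hc, δ, hδ, fun μ hμ => H μ (hst hμ)⟩
  · intro s t ihs iht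
    obtain ⟨c, hc, δ, hδ, H⟩ := ihs
    obtain ⟨c', hc', δ', hδ', H'⟩ := iht
    refine ⟨min c c', lt_min hc hc', min δ δ', lt_min hδ hδ', ?_⟩
    rintro μ (hμ | hμ)
    · exact shrink (min_le_left _ _) (min_le_left _ _) (H μ hμ)
    · exact shrink (min_le_right _ _) (min_le_right _ _) (H' μ hμ)
  · intro μ₀ hμ₀
    have hμΓ := hKΓ hμ₀
    have hlt := h.lt_add_single hμΓ i
    have hmem : μ₀ + Pi.single i 1 ∈ Γ := h.add_nonneg_mem hμΓ fun j => by
      by_cases hj : j = i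
      · subst hj; simp
      · simp [hj]
    obtain ⟨c, hc0, hc⟩ : ∃ c > 0, f μ₀ + c < f (μ₀ + Pi.single i 1) :=
      ⟨(f (μ₀ + Pi.single i 1) - f μ₀) / 2, by linarith, by linarith⟩
    let F : (Fin N → ℝ) × ℝ → Fin N → ℝ := fun q => q.1 + Pi.single i 1 - fun _ => q.2
    have hFc : Continuous F := by fun_prop
    have hF0 : F (μ₀, 0) = μ₀ + Pi.single i 1 := by ext; simp [F]
    have hcont : ∀ x ∈ Γ, ContinuousAt f x := fun x hx => (h.hasFDerivAt hx).continuousAt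
    have h1 : ∀ᶠ q in 𝓝 (μ₀, (0 : ℝ)), F q ∈ Γ :=
      hFc.continuousAt.eventually (by rw [hF0]; exact h.isOpen.mem_nhds hmem)
    have h2 : ∀ᶠ q in 𝓝 (μ₀, (0 : ℝ)), f q.1 + c < f (F q) := by
      refine ContinuousAt.eventually_lt ?_ ?_ (by rw [hF0]; exact hc)
      · exact ((hcont μ₀ hμΓ).comp (f := Prod.fst) (x := (μ₀, (0 : ℝ)))
          continuousAt_fst).add continuousAt_const
      · exact ContinuousAt.comp (by rw [hF0]; exact hcont _ hmem) hFc.continuousAt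
    have h3 := h1.and h2
    rw [nhds_prod_eq, eventually_prod_iff] at h3
    obtain ⟨pa, hpa, pb, hpb, H⟩ := h3
    obtain ⟨δ, hδ, hδ0⟩ :=
      ((hpb.filter_mono (nhdsWithin_le_nhds (s := Ioi 0))).and self_mem_nhdsWithin).exists
    refine ⟨{μ | pa μ}, mem_nhdsWithin_of_mem_nhds hpa, c, hc0, δ, hδ0, fun μ hμ => ?_⟩
    have := H hμ hδ
    exact ⟨this.1, this.2.le⟩

end Cone

section SchurHorn

variable {n : ℕ} {Γ : Set (Fin (n + 1) → ℝ)} {f : (Fin (n + 1) → ℝ) → ℝ}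

theorem IsStructure.perm_snoc (h : IsStructure Γ f) (σ : Equiv.Perm (Fin n)) {μ : Fin n → ℝ}
    {τ : ℝ} (hμ : Fin.snoc (α := fun _ => ℝ) μ τ ∈ Γ) :
    Fin.snoc (α := fun _ => ℝ) (μ ∘ σ) τ ∈ Γ ∧
      f (Fin.snoc (α := fun _ => ℝ) (μ ∘ σ) τ) = f (Fin.snoc (α := fun _ => ℝ) μ τ) := by
  let ρ : Equiv.Perm (Fin (n + 1)) :=
    { toFun := Fin.snoc (α := fun _ => Fin (n + 1)) (fun i => (σ i).castSucc) (Fin.last n)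
      invFun := Fin.snoc (α := fun _ => Fin (n + 1)) (fun i => (σ.symm i).castSucc) (Fin.last n)
      left_inv := fun i => by
        refine Fin.lastCases ?_ (fun i => ?_) i <;> simp
      right_inv := fun i => by
        refine Fin.lastCases ?_ (fun i => ?_) i <;> simp }
  have hρ : Fin.snoc (α := fun _ => ℝ) (μ ∘ σ) τ = Fin.snoc (α := fun _ => ℝ) μ τ ∘ ρ := by
    ext i
    refine Fin.lastCases ?_ (fun i => ?_) i <;> simp [ρ]
  rw [hρ]
  exact ⟨h.symm ρ _ hμ, h.f_symm ρ _ hμ⟩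

/-- Averaging the first `n` arguments by a doubly stochastic matrix stays in `Γ` and does not
decrease `f`: by Birkhoff's theorem the average is a convex combination of permutations. -/
theorem IsStructure.le_mulVec (h : IsStructure Γ f) {D : Matrix (Fin n) (Fin n) ℝ}
    (hD : D ∈ doublyStochastic ℝ (Fin n)) {μ : Fin n → ℝ} {τ : ℝ}
    (hμ : Fin.snoc (α := fun _ => ℝ) μ τ ∈ Γ) :
    Fin.snoc (α := fun _ => ℝ) (D.mulVec μ) τ ∈ Γ ∧
      f (Fin.snoc (α := fun _ => ℝ) μ τ) ≤ f (Fin.snoc (α := fun _ => ℝ) (D.mulVec μ) τ) := by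
  obtain ⟨w, hw0, hw1, hw⟩ := exists_eq_sum_perm_of_mem_doublyStochastic hD
  have key : Fin.snoc (α := fun _ => ℝ) (D.mulVec μ) τ =
      ∑ σ, w σ • Fin.snoc (α := fun _ => ℝ) (μ ∘ σ) τ := by
    ext i
    refine Fin.lastCases ?_ (fun i => ?_) i
    · simp [Finset.sum_apply, ← Finset.sum_mul, hw1]
    · rw [← hw]
      simp [Finset.sum_apply, Matrix.sum_mulVec, Matrix.smul_mulVec, Matrix.permMatrix_mulVec]
  rw [key]
  refine ⟨h.convex.sum_mem (fun σ _ => hw0 σ) hw1 fun σ _ => (h.perm_snoc σ hμ).1, ?_⟩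
  have := h.f_concave.le_map_sum (t := Finset.univ) (w := w)
    (p := fun σ : Equiv.Perm (Fin n) => Fin.snoc (α := fun _ => ℝ) (μ ∘ σ) τ)
    (fun σ _ => hw0 σ) hw1 fun σ _ => (h.perm_snoc σ hμ).1
  refine le_trans (le_of_eq ?_) this
  simp only [(h.perm_snoc _ hμ).2, smul_eq_mul]
  rw [← Finset.sum_mul, hw1, one_mul]

end SchurHorn

/-! ### Orthonormal frames and covectors -/

section Metric

variable {n : ℕ} [NeZero n] {M : Type*} [TopologicalSpace M]
  [ChartedSpace (EuclideanHalfSpace n) M] [IsManifold (𝓡∂ n) ∞ M] (g : Metric n M)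

theorem metric_self_nonneg (x : M) (v : TangentSpace (𝓡∂ n) x) : 0 ≤ g.inner x v v := by
  by_cases hv : v = 0
  · simp [hv]
  · exact (g.pos x v hv).le

theorem metric_cauchy_schwarz (x : M) (v w : TangentSpace (𝓡∂ n) x) :
    g.inner x v w ^ 2 ≤ g.inner x v v * g.inner x w w := by
  have h := discrim_le_zero (a := g.inner x v v) (b := 2 * g.inner x v w) (c := g.inner x w w)
    fun s => by
      have := metric_self_nonneg g x (s • v + w)
      simp only [map_add, map_smul, add_apply, smul_apply,
        smul_eq_mul, g.symm x w v] at this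
      linarith
  rw [discrim] at h
  nlinarith

/-- `|p| ≤ R` for a covector `p`, expressed by its values on unit vectors. -/
def CovBdd (x : M) (R : ℝ) (p : Cot n x) : Prop :=
  ∀ v : TangentSpace (𝓡∂ n) x, g.inner x v v ≤ 1 → |p v| ≤ R

variable {g}

theorem CovBdd.mono {x : M} {R R' : ℝ} {p : Cot n x} (h : CovBdd g x R p) (hR : R ≤ R') :
    CovBdd g x R' p := fun v hv => (h v hv).trans hR

theorem CovBdd.add {x : M} {R R' : ℝ} {p q : Cot n x} (h : CovBdd g x R p)
    (h' : CovBdd g x R' q) : CovBdd g x (R + R') (p + q) := fun v hv =>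
  (abs_add_le (p v) (q v)).trans (add_le_add (h v hv) (h' v hv))

theorem CovBdd.smul {x : M} {R : ℝ} {p : Cot n x} (h : CovBdd g x R p) (r : ℝ) :
    CovBdd g x (|r| * R) (r • p) := fun v hv => by
  have : |(r • p) v| = |r| * |p v| := by
    rw [← abs_mul]; rfl
  rw [this]
  exact mul_le_mul_of_nonneg_left (h v hv) (abs_nonneg r)

theorem CovBdd.sub {x : M} {R R' : ℝ} {p q : Cot n x} (h : CovBdd g x R p)
    (h' : CovBdd g x R' q) : CovBdd g x (R + R') (p - q) := fun v hv =>
  (abs_sub (p v) (q v)).trans (add_le_add (h v hv) (h' v hv))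

theorem CovBdd.nonneg {x : M} {R : ℝ} {p : Cot n x} (h : CovBdd g x R p) : 0 ≤ R :=
  (abs_nonneg _).trans (h 0 (by simp))

variable (g)

theorem metric_sharp (x : M) (p : Cot n x) (w : TangentSpace (𝓡∂ n) x) :
    g.inner x (sharp g x p) w = p w :=
  (exists_sharp g x p.toLinearMap).choose_spec w

theorem covBdd_of_covNorm_le {x : M} {p : Cot n x} {R : ℝ} (h : covNorm g x p ≤ R) :
    CovBdd g x R p := fun v hv => by
  refine le_trans ?_ h
  rw [← metric_sharp g x p v, covNorm]
  apply Real.le_sqrt_of_sq_le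
  rw [sq_abs]
  refine (metric_cauchy_schwarz g x _ _).trans ?_
  exact mul_le_of_le_one_right (metric_self_nonneg g x _) hv

theorem covBdd_inner {x : M} {e : TangentSpace (𝓡∂ n) x} (he : g.inner x e e ≤ 1) :
    CovBdd g x 1 (g.inner x e) := fun v hv => by
  rw [← sq_le_one_iff_abs_le_one]
  exact (metric_cauchy_schwarz g x e v).trans (mul_le_one₀ he (metric_self_nonneg g x v) hv)

theorem eq_of_metric_eq {x : M} {v w : TangentSpace (𝓡∂ n) x}
    (h : ∀ z, g.inner x v z = g.inner x w z) : v = w := by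
  by_contra hne
  have h1 := g.pos x (v - w) (sub_ne_zero.2 hne)
  have h2 : g.inner x (v - w) (v - w) = 0 := by
    have := h (v - w)
    rw [map_sub (g.inner x) v w, sub_apply, this, sub_self]
  exact h1.ne' h2

theorem sharp_add (x : M) (p q : Cot n x) : sharp g x (p + q) = sharp g x p + sharp g x q :=
  eq_of_metric_eq g fun z => by
    rw [metric_sharp, map_add]
    exact congrArg₂ (· + ·) (metric_sharp g x p z).symm (metric_sharp g x q z).symm

theorem sharp_smul (x : M) (r : ℝ) (p : Cot n x) : sharp g x (r • p) = r • sharp g x p :=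
  eq_of_metric_eq g fun z => by
    rw [metric_sharp, map_smul]
    exact congrArg (r * ·) (metric_sharp g x p z).symm

theorem orthonormal_expansion {x : M} (e : Module.Basis (Fin n) ℝ (TangentSpace (𝓡∂ n) x))
    (he : ∀ i j, g.inner x (e i) (e j) = if i = j then 1 else 0) (v : TangentSpace (𝓡∂ n) x) :
    v = ∑ j, g.inner x v (e j) • e j := by
  conv_lhs => rw [← e.sum_repr v]
  refine Finset.sum_congr rfl fun j _ => ?_
  congr 1
  conv_rhs => rw [← e.sum_repr v]
  simp only [map_sum, map_smul, sum_apply, smul_apply, he, smul_eq_mul]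
  simp

/-- The diagonal of a form in an orthonormal frame is the image of its eigenvalues under a doubly
stochastic matrix. -/
theorem IsEigenvalues.diag_eq_mulVec {x : M} {U : Form n x} {l : Fin n → ℝ}
    (hl : IsEigenvalues g x U l) (e : Module.Basis (Fin n) ℝ (TangentSpace (𝓡∂ n) x))
    (he : ∀ i j, g.inner x (e i) (e j) = if i = j then 1 else 0) :
    ∃ D ∈ doublyStochastic ℝ (Fin n), (fun i => U (e i) (e i)) = D.mulVec l := by
  obtain ⟨b, hb, hU⟩ := hl
  refine ⟨Matrix.of fun i j => g.inner x (e i) (b j) ^ 2, ?_, ?_⟩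
  · rw [mem_doublyStochastic_iff_sum]
    refine ⟨fun i j => sq_nonneg _, fun i => ?_, fun j => ?_⟩
    · have h1 := he i i
      rw [if_pos rfl] at h1
      conv_lhs at h1 => arg 2; rw [orthonormal_expansion g b hb (e i)]
      simp only [map_sum, map_smul, smul_eq_mul] at h1
      simpa [sq] using h1
    · have h1 := hb j j
      rw [if_pos rfl] at h1
      conv_lhs at h1 => arg 2; rw [orthonormal_expansion g e he (b j)]
      simp only [map_sum, map_smul, smul_eq_mul] at h1
      simpa [sq, g.symm x (b j)] using h1
  · funext i
    conv_lhs => rw [orthonormal_expansion g b hb (e i)]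
    simp only [map_sum, map_smul, LinearMap.sum_apply, LinearMap.smul_apply, smul_eq_mul, hU]
    simp [Matrix.mulVec, dotProduct, sq, mul_comm, mul_left_comm]

end Metric

/-! ### Coordinates -/

section CoordinateDomain

variable {n : ℕ} [NeZero n] {M : Type*} [TopologicalSpace M]
  [ChartedSpace (EuclideanHalfSpace n) M]

theorem mem_coordDom {T : ℝ} {c z : M} (hz : z ∈ (chartAt (EuclideanHalfSpace n) c).source)
    {t : ℝ} (ht : t ∈ Icc 0 T) (p : EE n →L[ℝ] ℝ) :
    (extChartAt (𝓡∂ n) c z, t, p) ∈ coordDom n T c :=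
  ⟨(extChartAt (𝓡∂ n) c).map_source (by simpa using hz), ht, mem_univ _⟩

theorem uniqueDiffOn_coordDom {T : ℝ} (hT : 0 < T) (c : M) :
    UniqueDiffOn ℝ (coordDom n T c) :=
  (uniqueDiffOn_extChartAt_target c).prod ((uniqueDiffOn_Icc hT).prod uniqueDiffOn_univ)

end CoordinateDomain

section Coordinates

variable {n : ℕ} [NeZero n] {M : Type*} [TopologicalSpace M]
  [ChartedSpace (EuclideanHalfSpace n) M] [IsManifold (𝓡∂ n) ∞ M]

theorem chartDinv_chartD {c z : M} (hz : z ∈ (chartAt (EuclideanHalfSpace n) c).source)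
    (v : TangentSpace (𝓡∂ n) z) : chartDinv n c z (chartD n c z v) = v :=
  (trivializationAt (EE n) (TangentSpace (𝓡∂ n)) c).symmL_continuousLinearMapAt
    (by simpa using hz) v

/-- Reading `ψ` in coordinates and evaluating at the coordinates of `(z, t, p)` gives
`ψ (z, t, p)`. -/
theorem coordFun_apply (ψ : (x : M) → ℝ → Cot n x → ℝ) {c z : M}
    (hz : z ∈ (chartAt (EuclideanHalfSpace n) c).source) (t : ℝ) (p : Cot n z) :
    coordFun ψ c (extChartAt (𝓡∂ n) c z, t, p.comp (chartDinv n c z)) = ψ z t p := by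
  have key : ∀ z', z' = z → ψ z' t ((p.comp (chartDinv n c z)).comp (chartD n c z')) = ψ z t p := by
    rintro z' rfl
    congr 1
    ext v
    exact congrArg p (chartDinv_chartD hz v)
  exact key _ ((extChartAt (𝓡∂ n) c).left_inv (by simpa using hz))

theorem chartDinv_self (x : M) : chartDinv n x x = ContinuousLinearMap.id ℝ (EE n) := by
  rw [chartDinv, TangentBundle.symmL_trivializationAt_eq_core (mem_chart_source _ x)]
  ext1 v
  exact (tangentBundleCore (𝓡∂ n) M).coordChange_self _ x (mem_chart_source _ x) v

open Bundle in
/-- Locally uniform comparison of the metric with the Euclidean norm in a chart. -/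
theorem exists_chart_bounds (g : Metric n M) (c : M) :
    ∃ C > 0, ∀ᶠ z in 𝓝 c, (∀ v, g.inner z v v ≤ 1 → ‖chartD n c z v‖ ≤ C) ∧
      ∀ R, ∀ p : Cot n z, CovBdd g z R p → ‖p.comp (chartDinv n c z)‖ ≤ R * C := by
  let _ : RiemannianBundle (fun x : M => TangentSpace (𝓡∂ n) x) := ⟨g.toRiemannianMetric⟩
  have : IsContinuousRiemannianBundle (EE n) (fun x : M => TangentSpace (𝓡∂ n) x) :=
    ⟨g.inner, g.contMDiff.continuous, fun _ _ _ => rfl⟩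
  obtain ⟨C₁, hC₁, h₁⟩ := eventually_norm_trivializationAt_lt (EE n)
    (fun x : M => TangentSpace (𝓡∂ n) x) c
  obtain ⟨C₂, hC₂, h₂⟩ := eventually_norm_symmL_trivializationAt_lt (EE n)
    (fun x : M => TangentSpace (𝓡∂ n) x) c
  have hnorm : ∀ (z : M) (v : TangentSpace (𝓡∂ n) z), ‖v‖ ^ 2 = g.inner z v v := fun z v =>
    (real_inner_self_eq_norm_sq v).symm
  refine ⟨max C₁ C₂, lt_max_of_lt_left hC₁, ?_⟩
  filter_upwards [h₁, h₂] with z hz₁ hz₂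
  refine ⟨fun v hv => ?_, fun R p hp => ?_⟩
  · have hv1 : ‖v‖ ≤ 1 := by
      rw [← hnorm] at hv
      exact (sq_le_one_iff₀ (norm_nonneg v)).1 hv
    calc ‖chartD n c z v‖ ≤ C₁ * ‖v‖ := ContinuousLinearMap.le_of_opNorm_le _ hz₁.le v
      _ ≤ C₁ * 1 := by gcongr
      _ ≤ max C₁ C₂ := by rw [mul_one]; exact le_max_left _ _
  · have hR := hp.nonneg
    refine ContinuousLinearMap.opNorm_le_bound _ (by positivity) fun v => ?_
    have hle : ‖chartDinv n c z v‖ ≤ C₂ * ‖v‖ := ContinuousLinearMap.le_of_opNorm_le _ hz₂.le v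
    have hpv : ∀ w : TangentSpace (𝓡∂ n) z, |p w| ≤ R * ‖w‖ := fun w => by
      by_cases hw : ‖w‖ = 0
      · rw [norm_eq_zero] at hw
        simp [hw]
      · have := hp (‖w‖⁻¹ • w) (by
          rw [← hnorm, norm_smul, norm_inv, norm_norm, inv_mul_cancel₀ hw]; norm_num)
        rw [map_smul, smul_eq_mul, abs_mul, abs_inv, abs_norm] at this
        rwa [inv_mul_le_iff₀ (by positivity), mul_comm] at this
    calc ‖p.comp (chartDinv n c z) v‖ ≤ R * ‖chartDinv n c z v‖ := hpv _
      _ ≤ R * (max C₁ C₂ * ‖v‖) := by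
        gcongr
        exact hle.trans (by gcongr; exact le_max_right _ _)
      _ = R * max C₁ C₂ * ‖v‖ := by ring

end Coordinates

/-! ### Uniform bounds for the coefficients -/

section Bounds

variable {n : ℕ} [NeZero n] {M : Type*} [TopologicalSpace M]
  [ChartedSpace (EuclideanHalfSpace n) M]

/-- A function that is smooth on a coordinate domain is Lipschitz in `(t, p)`, uniformly in `x`
over a compact subset of the chart domain and for bounded `p`. -/
theorem exists_lipschitz_coord {T : ℝ} (hT : 0 < T) {c : M} {N : Set M} (hN : IsCompact N)
    (hNs : N ⊆ (chartAt (EuclideanHalfSpace n) c).source)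
    {φ : EE n × ℝ × (EE n →L[ℝ] ℝ) → ℝ} (hφ : ContDiffOn ℝ ∞ φ (coordDom n T c)) (ρ : ℝ) :
    ∃ L ≥ 0, ∀ z ∈ N, ∀ t ∈ Icc 0 T, ∀ t' ∈ Icc 0 T, ∀ p p' : EE n →L[ℝ] ℝ, ‖p‖ ≤ ρ → ‖p'‖ ≤ ρ →
      |φ (extChartAt (𝓡∂ n) c z, t, p) - φ (extChartAt (𝓡∂ n) c z, t', p')| ≤
        L * (|t - t'| + ‖p - p'‖) := by
  let S : Set (EE n × ℝ × (EE n →L[ℝ] ℝ)) :=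
    (extChartAt (𝓡∂ n) c '' N) ×ˢ Icc 0 T ×ˢ Metric.closedBall 0 ρ
  have hNs' : N ⊆ (extChartAt (𝓡∂ n) c).source := by simpa using hNs
  have hS : IsCompact S := (hN.image_of_continuousOn
    ((continuousOn_extChartAt c).mono hNs')).prod
      (isCompact_Icc.prod (isCompact_closedBall _ _))
  have hSD : S ⊆ coordDom n T c := by
    rintro ⟨y, t, p⟩ ⟨⟨z, hz, rfl⟩, ht, -⟩
    exact mem_coordDom (hNs hz) ht p
  have hcont := (hφ.continuousOn_fderivWithin (uniqueDiffOn_coordDom hT c) (by simp)).mono hSD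
  obtain ⟨L, hL⟩ := hS.exists_bound_of_continuousOn hcont
  refine ⟨max L 0, le_max_right _ _, fun z hz t ht t' ht' p p' hp hp' => ?_⟩
  have hconv : Convex ℝ (Icc (0 : ℝ) T ×ˢ Metric.closedBall (0 : EE n →L[ℝ] ℝ) ρ) :=
    (convex_Icc _ _).prod (convex_closedBall _ _)
  set y := extChartAt (𝓡∂ n) c z
  have hd : ∀ q ∈ Icc (0 : ℝ) T ×ˢ Metric.closedBall (0 : EE n →L[ℝ] ℝ) ρ,
      HasFDerivWithinAt (fun q : ℝ × (EE n →L[ℝ] ℝ) => φ (y, q))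
        ((fderivWithin ℝ φ (coordDom n T c) (y, q)).comp
          (ContinuousLinearMap.inr ℝ (EE n) (ℝ × (EE n →L[ℝ] ℝ))))
        (Icc (0 : ℝ) T ×ˢ Metric.closedBall (0 : EE n →L[ℝ] ℝ) ρ) q := by
    intro q hq
    have hmem : ((y, q) : EE n × ℝ × (EE n →L[ℝ] ℝ)) ∈ coordDom n T c :=
      hSD ⟨mem_image_of_mem _ hz, hq⟩
    have h1 := ((hφ.differentiableOn (by simp)) _ hmem).hasFDerivWithinAt
    exact h1.comp q (hasFDerivAt_prodMk_right y q).hasFDerivWithinAt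
      fun q' hq' => hSD ⟨mem_image_of_mem _ hz, hq'⟩
  have hb : ∀ q ∈ Icc (0 : ℝ) T ×ˢ Metric.closedBall (0 : EE n →L[ℝ] ℝ) ρ,
      ‖(fderivWithin ℝ φ (coordDom n T c) (y, q)).comp
          (ContinuousLinearMap.inr ℝ (EE n) (ℝ × (EE n →L[ℝ] ℝ)))‖ ≤ max L 0 := by
    intro q hq
    refine (ContinuousLinearMap.opNorm_comp_le _ _).trans ?_
    have h1 := hL (y, q) ⟨mem_image_of_mem _ hz, hq⟩
    have h2 := ContinuousLinearMap.norm_inr_le_one ℝ (EE n) (ℝ × (EE n →L[ℝ] ℝ))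
    calc _ ≤ max L 0 * 1 := by
          gcongr
          exact h1.trans (le_max_left _ _)
      _ = max L 0 := mul_one _
  have := hconv.norm_image_sub_le_of_norm_hasFDerivWithin_le hd hb
    (x := (t', p')) (y := (t, p)) ⟨ht', by simpa using hp'⟩ ⟨ht, by simpa using hp⟩
  rw [Real.norm_eq_abs] at this
  refine this.trans ?_
  gcongr
  rw [Prod.norm_def]
  exact max_le_add_of_nonneg (norm_nonneg _) (norm_nonneg _)

variable [IsManifold (𝓡∂ n) ∞ M]

/-- The quadratic form `A (x, t, p)(e, e)`, for unit `e` and bounded `p`, is Lipschitz in `(t, p)`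
with a constant that does not depend on `x`. -/
theorem exists_lipschitz_tensor [T2Space M] [CompactSpace M] (g : Metric n M) {T : ℝ} (hT : 0 < T)
    {A : (x : M) → ℝ → Cot n x → Form n x} (hA : IsSmoothTensor T A) (R : ℝ) :
    ∃ C ≥ 0, ∀ x : M, ∀ t ∈ Icc 0 T, ∀ t' ∈ Icc 0 T, ∀ p p' : Cot n x, ∀ r : ℝ,
      ∀ e : TangentSpace (𝓡∂ n) x,
      CovBdd g x R p → CovBdd g x R p' → CovBdd g x r (p - p') → g.inner x e e ≤ 1 →
      |A x t p e e - A x t' p' e e| ≤ C * (|t - t'| + r) := by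
  suffices H : ∃ C ≥ 0, ∀ x ∈ (univ : Set M), ∀ t ∈ Icc 0 T, ∀ t' ∈ Icc 0 T, ∀ p p' : Cot n x,
      ∀ r : ℝ, ∀ e : TangentSpace (𝓡∂ n) x,
      CovBdd g x R p → CovBdd g x R p' → CovBdd g x r (p - p') → g.inner x e e ≤ 1 →
      |A x t p e e - A x t' p' e e| ≤ C * (|t - t'| + r) by
    obtain ⟨C, hC, H⟩ := H
    exact ⟨C, hC, fun x => H x (mem_univ x)⟩
  refine isCompact_univ.induction_on (p := fun s => ∃ C ≥ 0, ∀ x ∈ s, ∀ t ∈ Icc 0 T,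
      ∀ t' ∈ Icc 0 T, ∀ p p' : Cot n x, ∀ r : ℝ, ∀ e : TangentSpace (𝓡∂ n) x,
      CovBdd g x R p → CovBdd g x R p' → CovBdd g x r (p - p') → g.inner x e e ≤ 1 →
      |A x t p e e - A x t' p' e e| ≤ C * (|t - t'| + r)) ?_ ?_ ?_ ?_
  · exact ⟨0, le_rfl, by simp⟩
  · rintro s s' hs ⟨C, hC, H⟩
    exact ⟨C, hC, fun x hx => H x (hs hx)⟩
  · rintro s s' ⟨C, hC, H⟩ ⟨C', hC', H'⟩
    refine ⟨max C C', le_max_of_le_left hC, ?_⟩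
    rintro x (hx | hx) t ht t' ht' p p' r e hp hp' hr he
    · refine (H x hx t ht t' ht' p p' r e hp hp' hr he).trans ?_
      have := hr.nonneg
      gcongr
      exact le_max_left _ _
    · refine (H' x hx t ht t' ht' p p' r e hp hp' hr he).trans ?_
      have := hr.nonneg
      gcongr
      exact le_max_right _ _
  · intro c _
    obtain ⟨C₁, hC₁, hev⟩ := exists_chart_bounds g c
    obtain ⟨N, hNc, hNn, hNs⟩ : ∃ N, IsCompact N ∧ N ∈ 𝓝 c ∧
        N ⊆ (chartAt (EuclideanHalfSpace n) c).source := by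
      obtain ⟨N, hNn, hNs, hNc⟩ := local_compact_nhds
        ((chartAt (EuclideanHalfSpace n) c).open_source.mem_nhds (mem_chart_source _ c))
      exact ⟨N, hNc, hNn, hNs⟩
    let b := EuclideanSpace.basisFun (Fin n) ℝ
    choose L hL0 hL using fun i j : Fin n =>
      exists_lipschitz_coord hT hNc hNs (hA c (b i) (b j)) (R * C₁)
    have hL0' : 0 ≤ ∑ i, ∑ j, L i j :=
      Finset.sum_nonneg fun i _ => Finset.sum_nonneg fun j _ => hL0 i j
    refine ⟨{z | z ∈ N ∧ _}, mem_nhdsWithin_of_mem_nhds (Filter.inter_mem hNn hev),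
      C₁ * C₁ * (∑ i, ∑ j, L i j) * (1 + C₁), by positivity, ?_⟩
    rintro x ⟨hxN, hx₁, hx₂⟩ t ht t' ht' p p' r e hp hp' hr he
    have hxs := hNs hxN
    set v := chartD n c x e with hv
    have hvn : ‖v‖ ≤ C₁ := hx₁ e he
    have hcoord : ∀ i, |v i| ≤ C₁ := fun i => (PiLp.norm_apply_le v i).trans hvn
    have hev : e = ∑ i, v i • chartDinv n c x (b i) := by
      have h1 : v = ∑ i, v i • b i := by
        conv_lhs => rw [← b.sum_repr v]
        simp [b]
      calc e = chartDinv n c x v := (chartDinv_chartD hxs e).symm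
        _ = _ := by
          conv_lhs => rw [h1]
          simp [map_sum]
    have hquad : ∀ s (q : Cot n x), A x s q e e = ∑ i, ∑ j, v i * (v j *
        A x s q (chartDinv n c x (b i)) (chartDinv n c x (b j))) := by
      intro s q
      conv_lhs => rw [hev]
      simp only [map_sum, map_smul, LinearMap.sum_apply, LinearMap.smul_apply, smul_eq_mul,
        Finset.mul_sum]
      rw [Finset.sum_comm]
      exact Finset.sum_congr rfl fun i _ => Finset.sum_congr rfl fun j _ => by ring
    have hr0 := hr.nonneg
    have hterm : ∀ i j, |A x t p (chartDinv n c x (b i)) (chartDinv n c x (b j)) -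
        A x t' p' (chartDinv n c x (b i)) (chartDinv n c x (b j))| ≤
        L i j * ((1 + C₁) * (|t - t'| + r)) := by
      intro i j
      have h1 := hL i j x hxN t ht t' ht' (p.comp (chartDinv n c x)) (p'.comp (chartDinv n c x))
        (hx₂ R p hp) (hx₂ R p' hp')
      rw [coordFun_apply (fun x t p => A x t p (chartDinv n c x (b i)) (chartDinv n c x (b j)))
        hxs t p, coordFun_apply (fun x t p => A x t p (chartDinv n c x (b i))
        (chartDinv n c x (b j))) hxs t' p'] at h1
      refine h1.trans ?_
      have h2 : ‖p.comp (chartDinv n c x) - p'.comp (chartDinv n c x)‖ ≤ r * C₁ := by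
        have := hx₂ r (p - p') hr
        rwa [ContinuousLinearMap.sub_comp] at this
      have h3 := hL0 i j
      gcongr
      nlinarith [abs_nonneg (t - t')]
    rw [hquad, hquad, ← Finset.sum_sub_distrib]
    calc _ ≤ ∑ i, ∑ j, C₁ * (C₁ * (L i j * ((1 + C₁) * (|t - t'| + r)))) := by
          refine (Finset.abs_sum_le_sum_abs _ _).trans (Finset.sum_le_sum fun i _ => ?_)
          rw [← Finset.sum_sub_distrib]
          refine (Finset.abs_sum_le_sum_abs _ _).trans (Finset.sum_le_sum fun j _ => ?_)
          rw [← mul_sub, ← mul_sub, abs_mul, abs_mul]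
          exact mul_le_mul (hcoord i) (mul_le_mul (hcoord j) (hterm i j) (abs_nonneg _) hC₁.le)
            (by positivity) hC₁.le
      _ = C₁ * C₁ * (∑ i, ∑ j, L i j) * (1 + C₁) * (|t - t'| + r) := by
          simp only [Finset.mul_sum, Finset.sum_mul]
          exact Finset.sum_congr rfl fun i _ => Finset.sum_congr rfl fun j _ => by ring

/-- The `C²` bound controls the time derivative of `ψ` at fixed `(x, p)`. -/
theorem C2Bound.abs_deriv_time_le {𝒜 : FiniteAtlas n M} {g : Metric n M} {T B : ℝ} (hT : 0 < T)
    {ψ : (x : M) → ℝ → Cot n x → ℝ} (hψ : IsSmoothFun T ψ) (h : C2Bound 𝒜 g T B ψ) {x : M} {t : ℝ}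
    (ht : t ∈ Ioo 0 T) {p : Cot n x} (hp : covNorm g x p ≤ B) {d : ℝ}
    (hd : HasDerivAt (fun s => ψ x s p) d t) : |d| ≤ B := by
  obtain ⟨c, hc, hx⟩ := 𝒜.covers x
  have hxs := 𝒜.subset_source c hc hx
  have ht' := Ioo_subset_Icc_self ht
  have h1 := h c hc x hx t ht' p hp 1 (by norm_num)
  have hmem := mem_coordDom (n := n) hxs ht' (p.comp (chartDinv n c x))
  rw [norm_iteratedFDerivWithin_one _ (uniqueDiffOn_coordDom hT c _ hmem)] at h1
  have h2 := (((hψ c).differentiableOn (by simp)) _ hmem).hasFDerivWithinAt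
  have hline : HasDerivWithinAt
      (fun s : ℝ => (extChartAt (𝓡∂ n) c x, s, p.comp (chartDinv n c x)))
      ((0 : EE n), (1 : ℝ), (0 : EE n →L[ℝ] ℝ)) (Icc 0 T) t :=
    (hasDerivWithinAt_const t _ _).prodMk
      ((hasDerivWithinAt_id t _).prodMk (hasDerivWithinAt_const t _ _))
  have h3 := h2.comp_hasDerivWithinAt t hline fun s hs => mem_coordDom hxs hs _
  have h4 : HasDerivWithinAt (fun s => ψ x s p) _ (Icc 0 T) t :=
    h3.congr_of_mem (fun s _ => (coordFun_apply ψ hxs s p).symm) ht'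
  rw [(uniqueDiffOn_Icc hT t ht').eq_deriv _ hd.hasDerivWithinAt h4]
  refine (ContinuousLinearMap.le_of_opNorm_le _ h1 _).trans ?_
  have hB : 0 ≤ B := (norm_nonneg _).trans h1
  have : ‖((0 : EE n), (1 : ℝ), (0 : EE n →L[ℝ] ℝ))‖ = 1 := by simp [Prod.norm_def]
  rw [this, mul_one]

end Bounds

/-! ### Regularity of the coefficient tensor -/

section Regular

variable {n : ℕ} [NeZero n] {M : Type*} [TopologicalSpace M]
  [ChartedSpace (EuclideanHalfSpace n) M] [IsManifold (𝓡∂ n) ∞ M]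

theorem coordFun_self (ψ : (x : M) → ℝ → Cot n x → ℝ) (x : M) (t : ℝ) (p : EE n →L[ℝ] ℝ) :
    coordFun ψ x (extChartAt (𝓡∂ n) x x, t, p) = ψ x t p := by
  have h := coordFun_apply ψ (mem_chart_source (EuclideanHalfSpace n) x) t p
  rw [chartDinv_self] at h
  exact h

/-- At a fixed point of `M`, a smooth function on `T*M × [0, T]` is smooth in `(t, p)`. -/
theorem IsSmoothFun.contDiffOn_fiber {T : ℝ} {ψ : (x : M) → ℝ → Cot n x → ℝ}
    (hψ : IsSmoothFun T ψ) (x : M) :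
    ContDiffOn ℝ ∞ (fun q : ℝ × (EE n →L[ℝ] ℝ) => ψ x q.1 q.2) (Icc 0 T ×ˢ univ) := by
  have h := (hψ x).comp (f := fun q : ℝ × (EE n →L[ℝ] ℝ) => (extChartAt (𝓡∂ n) x x, q))
    (s := Icc 0 T ×ˢ univ) (by fun_prop)
    fun q hq => mem_coordDom (mem_chart_source _ x) hq.1 q.2
  exact h.congr fun q _ => (coordFun_self ψ x q.1 q.2).symm

theorem IsSmoothTensor.contDiffOn_fiber {T : ℝ} {A : (x : M) → ℝ → Cot n x → Form n x}
    (hA : IsSmoothTensor T A) (x : M) (v w : TangentSpace (𝓡∂ n) x) :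
    ContDiffOn ℝ ∞ (fun q : ℝ × (EE n →L[ℝ] ℝ) => A x q.1 q.2 v w) (Icc 0 T ×ˢ univ) := by
  have h := (hA x v w).comp (f := fun q : ℝ × (EE n →L[ℝ] ℝ) => (extChartAt (𝓡∂ n) x x, q))
    (s := Icc 0 T ×ˢ univ) (by fun_prop)
    fun q hq => mem_coordDom (mem_chart_source _ x) hq.1 q.2
  refine h.congr fun q _ => ?_
  have h1 := coordFun_self
    (fun z t p => A z t p (chartDinv n x z v) (chartDinv n x z w)) x q.1 q.2
  rw [chartDinv_self] at h1
  exact h1.symm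

/-- Concavity of `A (x, t, p)(e, e)` in the directions `ζ` that annihilate `e`. -/
theorem regular_concave {T : ℝ} {A : (x : M) → ℝ → Cot n x → Form n x}
    (hA : IsSmoothTensor T A) (hreg : IsRegular T (fun x t p => -A x t p)) {x : M} {t : ℝ}
    (ht : t ∈ Icc 0 T) {e : TangentSpace (𝓡∂ n) x} {p ζ : EE n →L[ℝ] ℝ} (hζ : ζ e = 0)
    {D : (EE n →L[ℝ] ℝ) →L[ℝ] ℝ}
    (hD : HasFDerivAt (fun q : EE n →L[ℝ] ℝ => A x t q e e) D p) :
    A x t (p + ζ) e e - A x t p e e ≤ D ζ := by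
  have hsm : ContDiff ℝ ∞ (fun q : EE n →L[ℝ] ℝ => A x t q e e) := by
    rw [← contDiffOn_univ]
    exact (hA.contDiffOn_fiber x e e).comp (f := fun q : EE n →L[ℝ] ℝ => (t, q)) (by fun_prop)
      fun q _ => ⟨ht, mem_univ _⟩
  let h : ℝ → ℝ := fun s => -A x t (p + s • ζ) e e
  have hs : ContDiff ℝ ∞ h := by
    have := hsm.comp (f := fun s : ℝ => p + s • ζ) (by fun_prop)
    exact this.neg
  have hconv : ConvexOn ℝ univ h := by
    refine convexOn_univ_of_deriv2_nonneg (hs.differentiable (by simp))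
      ((hs.iterate_deriv 1).differentiable (by simp)) fun s => ?_
    rw [← iteratedDeriv_eq_iterate]
    have h1 : 0 ≤ iteratedDeriv 2 (fun r => h (s + r)) 0 := by
      refine (hreg x t ht (p + s • ζ) ζ e hζ).trans_eq
        (congrArg (fun F => iteratedDeriv 2 F 0) (funext fun r => ?_))
      change -A x t (p + s • ζ + r • ζ) e e = -A x t (p + (s + r) • ζ) e e
      rw [add_smul, add_assoc]
    rw [iteratedDeriv_comp_const_add] at h1
    simpa using h1
  have hder : HasDerivAt h (-D ζ) 0 := by
    have h1 : HasDerivAt (fun s : ℝ => p + s • ζ) ζ 0 := by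
      simpa using ((hasDerivAt_id (0 : ℝ)).smul_const ζ).const_add p
    have h2 : HasFDerivAt (fun q : EE n →L[ℝ] ℝ => A x t q e e) D (p + (0 : ℝ) • ζ) := by
      simpa using hD
    exact (h2.comp_hasDerivAt (0 : ℝ) h1).neg
  have := hconv.le_slope_of_hasDerivAt (x := 0) (y := 1) (mem_univ _) (mem_univ _) one_pos hder
  simp [slope, h] at this
  linarith

/-- The quantitative form of regularity: the deviation of `A (x, t, ·)(e, e)` from its tangent is
controlled from above by the component `η e` alone, since the function is concave in the directions
orthogonal to `e` and Lipschitz in the remaining one. -/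
theorem regular_le {g : Metric n M} {T : ℝ} {A : (x : M) → ℝ → Cot n x → Form n x}
    (hA : IsSmoothTensor T A) (hreg : IsRegular T (fun x t p => -A x t p)) {x : M} {t : ℝ}
    (ht : t ∈ Icc 0 T) {B C : ℝ}
    (hC : ∀ p p' : Cot n x, ∀ r : ℝ, ∀ e : TangentSpace (𝓡∂ n) x,
      CovBdd g x (7 * B + 1) p → CovBdd g x (7 * B + 1) p' → CovBdd g x r (p - p') →
      g.inner x e e ≤ 1 → |A x t p e e - A x t p' e e| ≤ C * r)
    {e : TangentSpace (𝓡∂ n) x} (he : g.inner x e e = 1) {p η : EE n →L[ℝ] ℝ}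
    (hp : CovBdd g x B p) (hη : CovBdd g x (2 * B) η) {D : (EE n →L[ℝ] ℝ) →L[ℝ] ℝ}
    (hD : HasFDerivAt (fun q : EE n →L[ℝ] ℝ => A x t q e e) D p) :
    A x t (p + η) e e - A x t p e e - D η ≤ 2 * C * |η e| := by
  have hB := hp.nonneg
  let θ : EE n →L[ℝ] ℝ := g.inner x e
  have hθ : CovBdd g x 1 θ := covBdd_inner g he.le
  let ζ : EE n →L[ℝ] ℝ := η - η e • θ
  have hα : |η e| ≤ 2 * B := hη e he.le
  have hαθ : CovBdd g x |η e| (η e • θ) := (hθ.smul (η e)).mono (by simp)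
  have hζb : CovBdd g x (4 * B) ζ := (hη.sub hαθ).mono (by linarith)
  have hζ : ζ e = 0 := by
    change η e - η e * g.inner x e e = 0
    rw [he]; ring
  have h1 := regular_concave hA hreg ht hζ hD
  have h2 : |A x t (p + η) e e - A x t (p + ζ) e e| ≤ C * |η e| := by
    refine hC _ _ _ _ ((hp.add hη).mono (by linarith)) ((hp.add hζb).mono (by linarith)) ?_ he.le
    have : p + η - (p + ζ) = η e • θ := by simp [ζ]
    exact this ▸ hαθ
  have h3 : |D θ| ≤ C := by
    have hC0 : 0 ≤ C := by
      have hz : CovBdd g x (7 * B + 1) (0 : Cot n x) := fun v hv => by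
        simpa using (by linarith : 0 ≤ 7 * B + 1)
      have := hC 0 0 1 e hz hz (by intro v hv; simp) he.le
      simpa using this
    have hder : HasDerivAt (fun s : ℝ => A x t (p + s • θ) e e) (D θ) 0 := by
      have h1 : HasDerivAt (fun s : ℝ => p + s • θ) θ 0 := by
        simpa using ((hasDerivAt_id (0 : ℝ)).smul_const θ).const_add p
      have h2 : HasFDerivAt (fun q : EE n →L[ℝ] ℝ => A x t q e e) D (p + (0 : ℝ) • θ) := by
        simpa using hD
      exact h2.comp_hasDerivAt (0 : ℝ) h1
    refine hder.le_of_lip' hC0 ?_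
    filter_upwards [Metric.ball_mem_nhds (0 : ℝ) one_pos] with s hs
    have hs1 : |s| ≤ 1 := by simpa using (Metric.mem_ball.1 hs).le
    have hsθ : CovBdd g x |s| (s • θ) := (hθ.smul s).mono (by simp)
    have hp0 : p + (0 : ℝ) • θ = p := by simp
    have hps : p + s • θ - (p + (0 : ℝ) • θ) = s • θ := by simp
    have := hC (p + s • θ) (p + (0 : ℝ) • θ) |s| e ((hp.add hsθ).mono (by linarith))
      (hp0.symm ▸ hp.mono (by linarith)) (hps.symm ▸ hsθ) he.le
    simpa using this
  have h4 : D ζ = D η - η e * D θ := by simp [ζ]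
  have h5 : -(η e * D θ) ≤ C * |η e| := by
    calc -(η e * D θ) ≤ |η e * D θ| := neg_le_abs _
      _ = |η e| * |D θ| := abs_mul _ _
      _ ≤ |η e| * C := by gcongr
      _ = C * |η e| := mul_comm _ _
  have h6 := (abs_le.1 h2).2
  linarith

end Regular

/-! ### Space-time calculus -/

section Calculus

variable {E : Type*} [NormedAddCommGroup E]

theorem tendsto_slice_time (y : E) (t : ℝ) : Tendsto (fun s : ℝ => (y, s)) (𝓝 t) (𝓝 (y, t)) :=
  Continuous.tendsto (by fun_prop) t

theorem tendsto_slice_space (y : E) (t : ℝ) : Tendsto (fun z : E => (z, t)) (𝓝 y) (𝓝 (y, t)) :=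
  Continuous.tendsto (by fun_prop) y

variable [NormedSpace ℝ E]

/-- The time derivative of a function of `(y, t)`. -/
noncomputable def timeD (G : E × ℝ → ℝ) (q : E × ℝ) : ℝ := fderiv ℝ G q (0, 1)

theorem contDiffAt_fderiv_apply {G : E × ℝ → ℝ} {q : E × ℝ} {k l : WithTop ℕ∞}
    (hG : ContDiffAt ℝ l G q) (hk : k + 1 ≤ l) (v : E × ℝ) :
    ContDiffAt ℝ k (fun q => fderiv ℝ G q v) q :=
  (hG.fderiv_right hk).clm_apply contDiffAt_const

theorem fderiv_slice {G : E × ℝ → ℝ} {y : E} {t : ℝ} (hG : DifferentiableAt ℝ G (y, t)) :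
    fderiv ℝ (fun y => G (y, t)) y =
      (fderiv ℝ G (y, t)).comp (ContinuousLinearMap.inl ℝ E ℝ) :=
  (hG.hasFDerivAt.comp y (hasFDerivAt_prodMk_left y t)).fderiv

theorem hasDerivAt_time {G : E × ℝ → ℝ} {y : E} {t : ℝ} (hG : DifferentiableAt ℝ G (y, t)) :
    HasDerivAt (fun s => G (y, s)) (timeD G (y, t)) t := by
  have h : HasDerivAt (fun s : ℝ => (y, s)) ((0 : E), (1 : ℝ)) t :=
    (hasDerivAt_const t y).prodMk (hasDerivAt_id t)
  exact hG.hasFDerivAt.comp_hasDerivAt t h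

theorem fderiv_fderiv_apply {G : E × ℝ → ℝ} {q : E × ℝ} (hG : ContDiffAt ℝ 2 G q) (v w : E × ℝ) :
    fderiv ℝ (fun q => fderiv ℝ G q v) q w = fderiv ℝ (fderiv ℝ G) q w v := by
  have h : DifferentiableAt ℝ (fderiv ℝ G) q :=
    (hG.fderiv_right (m := 1) (by norm_num)).differentiableAt one_ne_zero
  have := (h.hasFDerivAt.clm_apply (hasFDerivAt_const v q)).fderiv
  rw [this]
  simp

theorem fderiv_fderiv_comm {G : E × ℝ → ℝ} {q : E × ℝ} (hG : ContDiffAt ℝ 2 G q) (v w : E × ℝ) :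
    fderiv ℝ (fun q => fderiv ℝ G q v) q w = fderiv ℝ (fun q => fderiv ℝ G q w) q v := by
  rw [fderiv_fderiv_apply hG, fderiv_fderiv_apply hG]
  exact (hG.isSymmSndFDerivAt (by simp)).eq w v

theorem _root_.ContDiffAt.eventually_differentiableAt {F : Type*} [NormedAddCommGroup F]
    [NormedSpace ℝ F] {G : F → ℝ} {q : F} (hG : ContDiffAt ℝ 1 G q) :
    ∀ᶠ q' in 𝓝 q, DifferentiableAt ℝ G q' :=
  (hG.eventually (by simp)).mono fun _ h => h.differentiableAt one_ne_zero

/-- The time derivative commutes with the spatial differential. -/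
theorem hasDerivAt_fderiv_slice {G : E × ℝ → ℝ} {y : E} {t : ℝ} (hG : ContDiffAt ℝ 2 G (y, t)) :
    HasDerivAt (fun s => fderiv ℝ (fun z => G (z, s)) y)
      (fderiv ℝ (fun z => timeD G (z, t)) y) t := by
  have hd : DifferentiableAt ℝ (fderiv ℝ G) (y, t) :=
    (hG.fderiv_right (m := 1) (by norm_num)).differentiableAt one_ne_zero
  have hev := (tendsto_slice_time y t).eventually
    (hG.of_le (by norm_num : (1 : WithTop ℕ∞) ≤ 2)).eventually_differentiableAt
  have h : HasDerivAt (fun s : ℝ => (y, s)) ((0 : E), (1 : ℝ)) t :=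
    (hasDerivAt_const t y).prodMk (hasDerivAt_id t)
  have h1 := hd.hasFDerivAt.comp_hasDerivAt t h
  have h2 : HasDerivAt
      (fun s => (fderiv ℝ G (y, s)).comp (ContinuousLinearMap.inl ℝ E ℝ))
      ((fderiv ℝ (fderiv ℝ G) (y, t) (0, 1)).comp (ContinuousLinearMap.inl ℝ E ℝ)) t :=
    h1.clm_comp (hasDerivAt_const t _) |>.congr_deriv (by simp)
  have h3 : fderiv ℝ (fun z => timeD G (z, t)) y =
      (fderiv ℝ (fderiv ℝ G) (y, t) (0, 1)).comp (ContinuousLinearMap.inl ℝ E ℝ) := by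
    have h4 : DifferentiableAt ℝ (timeD G) (y, t) :=
      (contDiffAt_fderiv_apply hG (k := 1) (by norm_num) _).differentiableAt one_ne_zero
    rw [fderiv_slice h4]
    ext v
    change fderiv ℝ (fun q => fderiv ℝ G q (0, 1)) (y, t) (v, 0) =
      fderiv ℝ (fderiv ℝ G) (y, t) (0, 1) (v, 0)
    rw [fderiv_fderiv_comm hG, fderiv_fderiv_apply hG]
  rw [h3]
  exact h2.congr_of_eventuallyEq (hev.mono fun s hs => fderiv_slice hs)

theorem fderiv_fderiv_slice {G : E × ℝ → ℝ} {y : E} {t : ℝ} (hG : ContDiffAt ℝ 2 G (y, t))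
    (v w : E) : fderiv ℝ (fun z => fderiv ℝ (fun z => G (z, t)) z) y v w =
      fderiv ℝ (fun z => fderiv ℝ G (z, t) (w, 0)) y v := by
  have hev := (tendsto_slice_space y t).eventually
    (hG.of_le (by norm_num : (1 : WithTop ℕ∞) ≤ 2)).eventually_differentiableAt
  have h1 : (fun z => fderiv ℝ (fun z => G (z, t)) z) =ᶠ[𝓝 y]
      fun z => (fderiv ℝ G (z, t)).comp (ContinuousLinearMap.inl ℝ E ℝ) :=
    hev.mono fun z hz => fderiv_slice hz
  have hd : DifferentiableAt ℝ (fun z => (fderiv ℝ G (z, t)).comp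
      (ContinuousLinearMap.inl ℝ E ℝ)) y := by
    have h2 : DifferentiableAt ℝ (fderiv ℝ G) (y, t) :=
      (hG.fderiv_right (m := 1) (by norm_num)).differentiableAt one_ne_zero
    have h3 : DifferentiableAt ℝ (fun z => fderiv ℝ G (z, t)) y :=
      h2.comp y (hasFDerivAt_prodMk_left y t).differentiableAt
    exact h3.clm_comp (differentiableAt_const _)
  rw [h1.fderiv_eq]
  have h4 := (hd.hasFDerivAt.clm_apply (hasFDerivAt_const w y)).fderiv
  have h5 : (fun z => fderiv ℝ G (z, t) (w, 0)) =
      fun z => ((fderiv ℝ G (z, t)).comp (ContinuousLinearMap.inl ℝ E ℝ)) w := by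
    ext z; simp
  rw [h5, h4]
  simp

/-- The time derivative commutes with second spatial derivatives. -/
theorem hasDerivAt_fderiv_fderiv_slice {G : E × ℝ → ℝ} {y : E} {t : ℝ}
    (hG : ContDiffAt ℝ 3 G (y, t)) (v w : E) :
    HasDerivAt (fun s => fderiv ℝ (fun z => fderiv ℝ (fun z => G (z, s)) z) y v w)
      (fderiv ℝ (fun z => fderiv ℝ (fun z => timeD G (z, t)) z) y v w) t := by
  have hev : ∀ᶠ q in 𝓝 (y, t), ContDiffAt ℝ 2 G q :=
    (hG.of_le (by norm_num : (2 : WithTop ℕ∞) ≤ 3)).eventually (by simp)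
  have hw : ContDiffAt ℝ 2 (fun q => fderiv ℝ G q (w, 0)) (y, t) :=
    contDiffAt_fderiv_apply hG (by norm_num) _
  have h1 := (hasDerivAt_fderiv_slice hw).clm_apply (hasDerivAt_const t v)
  have h2 : fderiv ℝ (fun z => timeD (fun q => fderiv ℝ G q (w, 0)) (z, t)) y v =
      fderiv ℝ (fun z => fderiv ℝ (fun z => timeD G (z, t)) z) y v w := by
    have hGt : ContDiffAt ℝ 2 (timeD G) (y, t) := contDiffAt_fderiv_apply hG (by norm_num) _
    rw [fderiv_fderiv_slice hGt]
    congr 1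
    refine Filter.EventuallyEq.fderiv_eq (((tendsto_slice_space y t).eventually hev).mono
      fun z hz => ?_)
    exact fderiv_fderiv_comm hz _ _
  have h3 := h1.congr_deriv (g' := fderiv ℝ (fun z => fderiv ℝ (fun z => timeD G (z, t)) z) y v w)
    (by simp [h2])
  refine h3.congr_of_eventuallyEq (((tendsto_slice_time y t).eventually hev).mono fun s hs => ?_)
  exact fderiv_fderiv_slice hs v w

/-! ### Necessary conditions at a maximum -/

theorem deriv_deriv_nonpos_of_isLocalMax {φ : ℝ → ℝ} {s : ℝ} (h : IsLocalMax φ s)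
    (hφ : ContinuousAt φ s) : deriv (deriv φ) s ≤ 0 := by
  by_contra! hpos
  have h1 := isLocalMin_of_deriv_deriv_pos hpos h.deriv_eq_zero hφ
  have h2 : φ =ᶠ[𝓝 s] fun _ => φ s := by
    filter_upwards [h, h1] with r hr hr'
    exact le_antisymm hr hr'
  have h3 : deriv (deriv φ) s = 0 := by
    have h4 : deriv φ =ᶠ[𝓝 s] fun _ => 0 := by
      simpa using h2.deriv
    rw [h4.deriv_eq]
    simp
  exact hpos.ne' h3

/-- First and second derivatives of a function along the line `s ↦ y + s v`. -/
theorem line_derivs {h : E → ℝ} {y : E} (hh : ContDiffAt ℝ 2 h y) (v : E) :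
    (∀ᶠ s in 𝓝 (0 : ℝ), HasDerivAt (fun s : ℝ => h (y + s • v)) (fderiv ℝ h (y + s • v) v) s) ∧
      HasDerivAt (fun s : ℝ => fderiv ℝ h (y + s • v) v)
        (fderiv ℝ (fun z => fderiv ℝ h z) y v v) 0 := by
  have hline : ∀ s, HasDerivAt (fun s : ℝ => y + s • v) v s := fun s => by
    simpa using ((hasDerivAt_id s).smul_const v).const_add y
  have htend : Tendsto (fun s : ℝ => y + s • v) (𝓝 0) (𝓝 y) := by
    simpa using (hline 0).continuousAt.tendsto
  constructor
  · filter_upwards [htend.eventually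
      (hh.of_le (by norm_num : (1 : WithTop ℕ∞) ≤ 2)).eventually_differentiableAt] with s hs
    exact hs.hasFDerivAt.comp_hasDerivAt s (hline s)
  · have hd : HasFDerivAt (fderiv ℝ h) (fderiv ℝ (fderiv ℝ h) y) (y + (0 : ℝ) • v) := by
      simpa using ((hh.fderiv_right (m := 1) (by norm_num)).differentiableAt
        one_ne_zero).hasFDerivAt
    have h1 := hd.comp_hasDerivAt (0 : ℝ) (hline 0)
    have h2 := h1.clm_apply (hasDerivAt_const (0 : ℝ) v)
    exact h2.congr_deriv (by simp)

/-- First and second order conditions at a local maximum of `σ h₁ + a exp (k h₂)`. -/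
theorem isLocalMax_add_exp {h₁ h₂ : E → ℝ} {y : E} (hh₁ : ContDiffAt ℝ 2 h₁ y)
    (hh₂ : ContDiffAt ℝ 2 h₂ y) (σ a k : ℝ)
    (hmax : IsLocalMax (fun z => σ * h₁ z + a * Real.exp (k * h₂ z)) y) :
    (∀ v, σ * fderiv ℝ h₁ y v + a * k * Real.exp (k * h₂ y) * fderiv ℝ h₂ y v = 0) ∧
    ∀ v, σ * fderiv ℝ (fun z => fderiv ℝ h₁ z) y v v + a * k * Real.exp (k * h₂ y) *
      (fderiv ℝ (fun z => fderiv ℝ h₂ z) y v v + k * fderiv ℝ h₂ y v ^ 2) ≤ 0 := by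
  have main : ∀ v : E, _ ∧ _ := fun v => by
    obtain ⟨hA, hA'⟩ := line_derivs hh₁ v
    obtain ⟨hB, hB'⟩ := line_derivs hh₂ v
    let φ : ℝ → ℝ := fun s => σ * h₁ (y + s • v) + a * Real.exp (k * h₂ (y + s • v))
    have hφ : ∀ᶠ s in 𝓝 (0 : ℝ), HasDerivAt φ (σ * fderiv ℝ h₁ (y + s • v) v +
        a * (Real.exp (k * h₂ (y + s • v)) * (k * fderiv ℝ h₂ (y + s • v) v))) s := by
      filter_upwards [hA, hB] with s hs hs'
      exact (hs.const_mul σ).add (((hs'.const_mul k).exp).const_mul a)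
    have hmaxφ : IsLocalMax φ 0 := by
      have htend : Tendsto (fun s : ℝ => y + s • v) (𝓝 0) (𝓝 y) :=
        Continuous.tendsto' (by fun_prop) _ _ (by simp)
      have := htend.eventually hmax
      filter_upwards [this] with s hs
      simpa [φ] using hs
    have h0 := hφ.self_of_nhds
    have hB0 := hB.self_of_nhds
    have hderiv : deriv φ =ᶠ[𝓝 0] fun s => σ * fderiv ℝ h₁ (y + s • v) v +
        a * (Real.exp (k * h₂ (y + s • v)) * (k * fderiv ℝ h₂ (y + s • v) v)) :=
      hφ.mono fun s hs => hs.deriv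
    have h2 := deriv_deriv_nonpos_of_isLocalMax hmaxφ h0.continuousAt
    have h3 := (hA'.const_mul σ).add
      (((((hB0.const_mul k).exp).mul (hB'.const_mul k))).const_mul a)
    rw [hderiv.deriv_eq] at h2
    replace h2 := h3.deriv.symm.trans_le h2
    have h4 := hmaxφ.hasDerivAt_eq_zero h0
    simp only [zero_smul, add_zero] at h2 h4
    have e1 : σ * fderiv ℝ h₁ y v + a * k * Real.exp (k * h₂ y) * fderiv ℝ h₂ y v = 0 := by
      rw [← h4]; ring
    have e2 : σ * fderiv ℝ (fun z => fderiv ℝ h₁ z) y v v + a * k * Real.exp (k * h₂ y) *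
        (fderiv ℝ (fun z => fderiv ℝ h₂ z) y v v + k * fderiv ℝ h₂ y v ^ 2) ≤ 0 := by
      refine le_of_eq_of_le ?_ h2
      ring
    exact ⟨e1, e2⟩
  exact ⟨fun v => (main v).1, fun v => (main v).2⟩

/-- At a maximum over `[0, S]` at a positive time, possibly the endpoint `S`, the time derivative is
nonnegative. -/
theorem deriv_nonneg_of_isMaxOn_Icc {φ : ℝ → ℝ} {t S d : ℝ} (h0 : 0 < t) (hS : t ≤ S)
    (hmax : ∀ s ∈ Icc 0 S, φ s ≤ φ t) (hd : HasDerivAt φ d t) : 0 ≤ d := by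
  by_contra! hneg
  have h1 : ∀ᶠ s in 𝓝[<] t, slope φ t s < 0 := by
    have := hasDerivAt_iff_tendsto_slope.1 hd
    exact (this.eventually_lt_const hneg).filter_mono
      (nhdsWithin_mono t fun s hs => ne_of_lt hs)
  have h2 : ∀ᶠ s in 𝓝[<] t, s ∈ Ioo 0 t := Ioo_mem_nhdsLT h0
  obtain ⟨s, hs, hs'⟩ := (h1.and h2).exists
  have h3 := hmax s ⟨hs'.1.le, hs'.2.le.trans hS⟩
  rw [slope_def_field, div_lt_iff_of_neg (by linarith [hs'.2])] at hs
  linarith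

end Calculus

/-! ### Derivatives on the manifold in the centred chart -/

section Chart

variable {n : ℕ} [NeZero n] {M : Type*} [TopologicalSpace M]
  [ChartedSpace (EuclideanHalfSpace n) M]

/-- A function on `M × ℝ` read in the chart centred at `c`. -/
noncomputable def chartFn (u : M → ℝ → ℝ) (c : M) (q : EE n × ℝ) : ℝ :=
  u ((extChartAt (𝓡∂ n) c).symm q.1) q.2

theorem chartFn_apply (u : M → ℝ → ℝ) {c x : M} (hx : x ∈ (extChartAt (𝓡∂ n) c).source) (t : ℝ) :
    chartFn u c (extChartAt (𝓡∂ n) c x, t) = u x t := by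
  rw [chartFn, (extChartAt (𝓡∂ n) c).left_inv hx]

theorem chartFn_self (u : M → ℝ → ℝ) (x : M) (t : ℝ) :
    chartFn u x (extChartAt (𝓡∂ n) x x, t) = u x t :=
  chartFn_apply u (mem_extChartAt_source x) t

theorem IsCk.contDiffOn [IsManifold (𝓡∂ n) ∞ M] {k : ℕ} {T : ℝ} {u : M → ℝ → ℝ}
    (hu : IsCk n k T u) (c : M) :
    ContDiffOn ℝ k (chartFn u c) ((extChartAt (𝓡∂ n) c).target ×ˢ Icc 0 T) := by
  have : IsManifold (𝓡∂ n) (k : WithTop ℕ∞) M := IsManifold.of_le (n := ∞) (mod_cast le_top)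
  have h1 : ContMDiffOn (𝓘(ℝ, EE n).prod 𝓘(ℝ, ℝ)) ((𝓡∂ n).prod 𝓘(ℝ, ℝ)) k
      (Prod.map (extChartAt (𝓡∂ n) c).symm (id : ℝ → ℝ))
      ((extChartAt (𝓡∂ n) c).target ×ˢ Icc 0 T) :=
    (contMDiffOn_extChartAt_symm c).prodMap contMDiffOn_id
  have h2 := hu.comp h1 fun q hq => ⟨mem_univ _, hq.2⟩
  rw [← modelWithCornersSelf_prod, chartedSpaceSelf_prod] at h2
  exact h2.contDiffOn

theorem range_mem_nhds {x : M} (hx : x ∈ (𝓡∂ n).interior M) :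
    range (𝓡∂ n) ∈ 𝓝 (extChartAt (𝓡∂ n) x x) :=
  mem_interior_iff_mem_nhds.1 hx

theorem target_mem_nhds {x : M} (hx : x ∈ (𝓡∂ n).interior M) :
    (extChartAt (𝓡∂ n) x).target ∈ 𝓝 (extChartAt (𝓡∂ n) x x) := by
  have h := extChartAt_target_mem_nhdsWithin (I := 𝓡∂ n) x
  rwa [nhdsWithin_eq_nhds.2 (range_mem_nhds hx)] at h

theorem IsCk.contDiffAt [IsManifold (𝓡∂ n) ∞ M] {k : ℕ} {T : ℝ} {u : M → ℝ → ℝ}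
    (hu : IsCk n k T u) {x : M} (hx : x ∈ (𝓡∂ n).interior M) {t : ℝ} (ht : t ∈ Ioo 0 T) :
    ContDiffAt ℝ k (chartFn u x) (extChartAt (𝓡∂ n) x x, t) :=
  (hu.contDiffOn x).contDiffAt (prod_mem_nhds (target_mem_nhds hx) (Icc_mem_nhds ht.1 ht.2))

theorem coordD2_eq (w : M → ℝ) {x : M} (hx : x ∈ (𝓡∂ n).interior M) :
    coordD2 n w x = fderiv ℝ (fun y => fderiv ℝ (fun y => w ((extChartAt (𝓡∂ n) x).symm y)) y)
      (extChartAt (𝓡∂ n) x x) := by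
  have hr := range_mem_nhds hx
  rw [coordD2, fderivWithin_of_mem_nhds hr]
  refine Filter.EventuallyEq.fderiv_eq ?_
  filter_upwards [eventually_mem_nhds_iff.2 hr] with y hy
  rw [fderivWithin_of_mem_nhds hy]
  rfl

theorem du_eq [IsManifold (𝓡∂ n) ∞ M] {k : ℕ} (hk : 1 ≤ k) {T : ℝ} {u : M → ℝ → ℝ}
    (hu : IsCk n k T u) {x : M} (hx : x ∈ (𝓡∂ n).interior M) {t : ℝ} (ht : t ∈ Icc 0 T) :
    du n u x t = fderiv ℝ (fun y => chartFn u x (y, t)) (extChartAt (𝓡∂ n) x x) := by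
  have h1 : ContMDiff (𝓡∂ n) 𝓘(ℝ, ℝ) k (fun y => u y t) := by
    have h2 : ContMDiff (𝓡∂ n) ((𝓡∂ n).prod 𝓘(ℝ, ℝ)) k (fun y : M => (y, t)) :=
      contMDiff_id.prodMk contMDiff_const
    rw [← contMDiffOn_univ] at h2 ⊢
    exact hu.comp h2 fun y _ => ⟨mem_univ _, ht⟩
  have h2 : MDifferentiableAt (𝓡∂ n) 𝓘(ℝ, ℝ) (fun y => u y t) x :=
    (h1 x).mdifferentiableAt (by exact_mod_cast (by omega : k ≠ 0))
  exact h2.mfderiv.trans (fderivWithin_of_mem_nhds (range_mem_nhds hx))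

theorem ut_eq_timeD {T : ℝ} {u : M → ℝ → ℝ} {x z : M} (hz : z ∈ (extChartAt (𝓡∂ n) x).source)
    {t : ℝ} (ht : t ∈ Ioo 0 T)
    (hd : DifferentiableAt ℝ (chartFn u x) (extChartAt (𝓡∂ n) x z, t)) :
    ut T u z t = timeD (chartFn u x) (extChartAt (𝓡∂ n) x z, t) := by
  have h := ((hasDerivAt_time hd).hasDerivWithinAt (s := Icc 0 T)).derivWithin
    (uniqueDiffWithinAt_of_mem_nhds (Icc_mem_nhds ht.1 ht.2))
  rw [← h, ut]
  congr 1
  funext s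
  exact (chartFn_apply u hz s).symm

theorem continuousOn_ut [IsManifold (𝓡∂ n) ∞ M] {k : ℕ} (hk : 1 ≤ k) {T : ℝ} (hT : 0 < T)
    {u : M → ℝ → ℝ} (hu : IsCk n k T u) :
    ContinuousOn (fun q : M × ℝ => ut T u q.1 q.2) (univ ×ˢ Icc 0 T) := by
  rintro ⟨x, t⟩ ⟨-, ht⟩
  let S := (extChartAt (𝓡∂ n) x).target ×ˢ Icc 0 T
  have hS : UniqueDiffOn ℝ S := (uniqueDiffOn_extChartAt_target x).prod (uniqueDiffOn_Icc hT)
  have hG := hu.contDiffOn x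
  have hk1 : (1 : WithTop ℕ∞) ≤ k := by exact_mod_cast hk
  have hcont : ContinuousOn (fun q => fderivWithin ℝ (chartFn u x) S q ((0 : EE n), (1 : ℝ))) S :=
    (hG.continuousOn_fderivWithin hS hk1).clm_apply continuousOn_const
  have hsrc : (extChartAt (𝓡∂ n) x).source ∈ 𝓝 x := extChartAt_source_mem_nhds x
  have hmaps : MapsTo (fun q : M × ℝ => (extChartAt (𝓡∂ n) x q.1, q.2))
      ((extChartAt (𝓡∂ n) x).source ×ˢ Icc 0 T) S :=
    fun q hq => ⟨(extChartAt (𝓡∂ n) x).map_source hq.1, hq.2⟩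
  have hchart : ContinuousOn (fun q : M × ℝ => (extChartAt (𝓡∂ n) x q.1, q.2))
      ((extChartAt (𝓡∂ n) x).source ×ˢ Icc 0 T) :=
    ((continuousOn_extChartAt x).comp continuousOn_fst fun q hq => hq.1).prodMk continuousOn_snd
  have hcomp := hcont.comp hchart hmaps
  have heq : ∀ q ∈ (extChartAt (𝓡∂ n) x).source ×ˢ Icc 0 T, ut T u q.1 q.2 =
      fderivWithin ℝ (chartFn u x) S (extChartAt (𝓡∂ n) x q.1, q.2) ((0 : EE n), (1 : ℝ)) := by
    rintro ⟨z, s⟩ ⟨hz, hs⟩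
    have hd := ((hG.differentiableOn (by exact_mod_cast (by omega : k ≠ 0))) _
      (hmaps ⟨hz, hs⟩ : ((extChartAt (𝓡∂ n) x z, s) : EE n × ℝ) ∈ S)).hasFDerivWithinAt
    have hline : HasDerivWithinAt (fun r : ℝ => (extChartAt (𝓡∂ n) x z, r))
        ((0 : EE n), (1 : ℝ)) (Icc 0 T) s :=
      (hasDerivWithinAt_const s _ _).prodMk (hasDerivWithinAt_id s _)
    have h1 := hd.comp_hasDerivWithinAt s hline
      fun r (hr : r ∈ Icc 0 T) => hmaps (⟨hz, hr⟩ : (z, r) ∈ _ ×ˢ _)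
    have h2 := h1.derivWithin (uniqueDiffOn_Icc hT s hs)
    rw [← h2, ut]
    congr 1
    funext r
    exact (chartFn_apply u hz r).symm
  have h3 := (hcomp.congr heq) (x, t) ⟨mem_extChartAt_source x, ht⟩
  refine h3.mono_of_mem_nhdsWithin ?_
  rw [nhdsWithin_prod_eq, nhdsWithin_univ]
  exact prod_mem_prod hsrc self_mem_nhdsWithin

theorem IsCk.continuousOn {k : ℕ} {T : ℝ} {u : M → ℝ → ℝ} (hu : IsCk n k T u) :
    ContinuousOn (fun q : M × ℝ => u q.1 q.2) (univ ×ˢ Icc 0 T) :=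
  ContMDiffOn.continuousOn hu

end Chart

/-! ### The Hessian and its spectrum -/

theorem fderivWithin_bilin_symm {V : Type*} [NormedAddCommGroup V] [NormedSpace ℝ V]
    {F : V → V →L[ℝ] V →L[ℝ] ℝ} (hF : ∀ y v w, F y v w = F y w v) {s : Set V} {y : V}
    (hs : UniqueDiffWithinAt ℝ s y) (X v w : V) :
    fderivWithin ℝ F s y X v w = fderivWithin ℝ F s y X w v := by
  by_cases hd : DifferentiableWithinAt ℝ F s y
  · have key : ∀ v w, fderivWithin ℝ (fun z => F z v w) s y X = fderivWithin ℝ F s y X v w := by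
      intro v w
      have h1 := (hd.hasFDerivWithinAt.clm_apply (hasFDerivWithinAt_const v y s)).clm_apply
        (hasFDerivWithinAt_const w y s)
      rw [h1.fderivWithin hs]
      simp
    rw [← key v w, ← key w v]
    simp only [hF _ v w]
  · simp [fderivWithin_zero_of_not_differentiableWithinAt hd]

section Hessian

variable {n : ℕ} [NeZero n] {M : Type*} [TopologicalSpace M]
  [ChartedSpace (EuclideanHalfSpace n) M] [IsManifold (𝓡∂ n) ∞ M] (g : Metric n M)

theorem dMetric_symm (x : M) (X v w : EE n) : dMetric g x X v w = dMetric g x X w v := by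
  exact fderivWithin_bilin_symm (fun y v w => g.symm _ _ _)
    ((𝓡∂ n).uniqueDiffOn.uniqueDiffWithinAt (mem_range_self _)) X v w

theorem christoffelTerm_add (x : M) (X Y v w : EE n) :
    christoffelTerm g x (X + Y) v w = christoffelTerm g x X v w + christoffelTerm g x Y v w := by
  simp only [christoffelTerm, LinearMap.mk₂_apply, map_add, add_apply]
  ring

theorem christoffelTerm_smul (x : M) (r : ℝ) (X v w : EE n) :
    christoffelTerm g x (r • X) v w = r * christoffelTerm g x X v w := by
  simp only [christoffelTerm, LinearMap.mk₂_apply, map_smul, smul_apply, smul_eq_mul]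
  ring

theorem christoffelTerm_symm (x : M) (X v w : EE n) :
    christoffelTerm g x X v w = christoffelTerm g x X w v := by
  simp only [christoffelTerm, LinearMap.mk₂_apply]
  rw [dMetric_symm g x X v w]
  ring

/-- The first order part `p ↦ Γ_{ij}^k p_k v^i w^j` of the Hessian. -/
noncomputable def christoffelCov (x : M) (v w : EE n) : (EE n →L[ℝ] ℝ) →L[ℝ] ℝ :=
  LinearMap.toContinuousLinearMap
    { toFun := fun p => christoffelTerm g x (sharp g x p) v w
      map_add' := fun p q => by
        have h : (sharp g x (p + q) : EE n) = sharp g x p + sharp g x q := sharp_add g x p q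
        rw [h]
        exact christoffelTerm_add g x _ _ v w
      map_smul' := fun r p => by
        have h : (sharp g x (r • p) : EE n) = r • sharp g x p := sharp_smul g x r p
        rw [h]
        exact christoffelTerm_smul g x r _ v w }

theorem christoffelCov_symm (x : M) (v w : EE n) (p : EE n →L[ℝ] ℝ) :
    christoffelCov g x v w p = christoffelCov g x w v p :=
  christoffelTerm_symm g x _ v w

variable {g} {k : ℕ} {T : ℝ} {u : M → ℝ → ℝ}

theorem hess_eq (hk : 1 ≤ k) (hu : IsCk n k T u) {x : M} (hx : x ∈ (𝓡∂ n).interior M) {t : ℝ}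
    (ht : t ∈ Icc 0 T) (v w : EE n) :
    hess g u x t v w =
      fderiv ℝ (fun z => fderiv ℝ (fun z => chartFn u x (z, t)) z) (extChartAt (𝓡∂ n) x x) v w -
      christoffelCov g x v w
        (fderiv ℝ (fun z => chartFn u x (z, t)) (extChartAt (𝓡∂ n) x x)) := by
  rw [← du_eq hk hu hx ht]
  change coordD2 n (fun y => u y t) x v w - christoffelTerm g x (sharp g x (du n u x t)) v w = _
  rw [coordD2_eq _ hx]
  rfl

theorem hess_symm (hk : 2 ≤ k) (hu : IsCk n k T u) {x : M} (hx : x ∈ (𝓡∂ n).interior M) {t : ℝ}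
    (ht : t ∈ Ioo 0 T) (v w : EE n) : hess g u x t v w = hess g u x t w v := by
  have ht' := Ioo_subset_Icc_self ht
  rw [hess_eq (by omega) hu hx ht', hess_eq (by omega) hu hx ht', christoffelCov_symm]
  congr 1
  have h2 : ContDiffAt ℝ 2 (chartFn u x) (extChartAt (𝓡∂ n) x x, t) :=
    (hu.contDiffAt hx ht).of_le (by exact_mod_cast hk)
  have h3 : ContDiffAt ℝ 2 (fun z => chartFn u x (z, t)) (extChartAt (𝓡∂ n) x x) :=
    h2.comp (f := fun z => (z, t)) _ (contDiffAt_id.prodMk contDiffAt_const)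
  exact (h3.isSymmSndFDerivAt (by simp)).eq v w

theorem isEigenvalues_eigs {x : M} {U : Form n x} (hU : ∀ v w, U v w = U w v) :
    IsEigenvalues g x U (eigs g x U) := by
  have h := exists_isEigenvalues g x U hU
  rw [eigs, dif_pos h]
  exact h.choose_spec

/-- The form `∇²u + A[u]`. -/
noncomputable def augHess (g : Metric n M) (A : (x : M) → ℝ → Cot n x → Form n x)
    (u : M → ℝ → ℝ) (x : M) (t : ℝ) : Form n x :=
  hess g u x t + A x t (du n u x t)

variable {A : (x : M) → ℝ → Cot n x → Form n x}

theorem isEigenvalues_augHess (hA : ∀ x : M, ∀ t ∈ Icc 0 T, ∀ p v w, A x t p v w = A x t p w v)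
    (hk : 2 ≤ k) (hu : IsCk n k T u) {x : M} (hx : x ∈ (𝓡∂ n).interior M) {t : ℝ}
    (ht : t ∈ Ioo 0 T) :
    IsEigenvalues g x (augHess g A u x t) (eigs g x (augHess g A u x t)) :=
  isEigenvalues_eigs fun v w =>
    congrArg₂ (· + ·) (hess_symm hk hu hx ht v w) (hA x t (Ioo_subset_Icc_self ht) _ v w)

/-- The point of `ℝ^{n+1}` formed by the diagonal of `∇²u + A[u]` in a frame, and `-u_t`. -/
noncomputable def diagPt (g : Metric n M) (T : ℝ) (A : (x : M) → ℝ → Cot n x → Form n x)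
    (u : M → ℝ → ℝ) (x : M) (e : Fin n → TangentSpace (𝓡∂ n) x) (t : ℝ) : Fin (n + 1) → ℝ :=
  Fin.snoc (α := fun _ => ℝ) (fun i => augHess g A u x t (e i) (e i)) (-ut T u x t)

variable {Γ : Set (Fin (n + 1) → ℝ)} {f : (Fin (n + 1) → ℝ) → ℝ}

/-- In any orthonormal frame the diagonal point lies in `Γ`, where `f` is at least its value at the
spectrum. The vector `(s, …, s, s')` allows for a shift of the spectrum. -/
theorem le_diagPt (hf : IsStructure Γ f)
    (hA : ∀ x : M, ∀ t ∈ Icc 0 T, ∀ p v w, A x t p v w = A x t p w v)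
    (hk : 2 ≤ k) (hu : IsCk n k T u) {x : M} (hx : x ∈ (𝓡∂ n).interior M) {t : ℝ}
    (ht : t ∈ Ioo 0 T) (e : Module.Basis (Fin n) ℝ (TangentSpace (𝓡∂ n) x))
    (he : ∀ i j, g.inner x (e i) (e j) = if i = j then 1 else 0) (s s' : ℝ)
    (hΓ : spec g T A u x t + Fin.snoc (α := fun _ => ℝ) (fun _ : Fin n => s) s' ∈ Γ) :
    diagPt g T A u x e t + Fin.snoc (α := fun _ => ℝ) (fun _ : Fin n => s) s' ∈ Γ ∧
    f (spec g T A u x t + Fin.snoc (α := fun _ => ℝ) (fun _ : Fin n => s) s') ≤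
      f (diagPt g T A u x e t + Fin.snoc (α := fun _ => ℝ) (fun _ : Fin n => s) s') := by
  obtain ⟨D, hD, hdiag⟩ := (isEigenvalues_augHess hA hk hu hx ht).diag_eq_mulVec g e he
  have h1 : spec g T A u x t + Fin.snoc (α := fun _ => ℝ) (fun _ : Fin n => s) s' =
      Fin.snoc (α := fun _ => ℝ) (eigs g x (augHess g A u x t) + fun _ => s)
        (-ut T u x t + s') := by
    ext i
    refine Fin.lastCases ?_ (fun i => ?_) i <;> simp [spec, augHess]
  have h2 : diagPt g T A u x e t + Fin.snoc (α := fun _ => ℝ) (fun _ : Fin n => s) s' =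
      Fin.snoc (α := fun _ => ℝ) (D.mulVec (eigs g x (augHess g A u x t) + fun _ => s))
        (-ut T u x t + s') := by
    have h3 : D.mulVec (fun _ => s) = fun _ => s := by
      funext i
      simp [Matrix.mulVec, dotProduct, ← Finset.sum_mul, sum_row_of_mem_doublyStochastic hD]
    rw [Matrix.mulVec_add, ← hdiag, h3]
    ext i
    refine Fin.lastCases ?_ (fun i => ?_) i <;> simp [diagPt]
  rw [h1] at hΓ ⊢
  rw [h2]
  exact hf.le_mulVec hD hΓ

end Hessian

/-! ### Time derivatives along a solution -/

section TimeDerivative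

variable {n : ℕ} [NeZero n] {M : Type*} [TopologicalSpace M]
  [ChartedSpace (EuclideanHalfSpace n) M] [IsManifold (𝓡∂ n) ∞ M] {k : ℕ} {T : ℝ}
  {u : M → ℝ → ℝ}

theorem IsCk.hasDerivAt_time (hk : 1 ≤ k) (hu : IsCk n k T u) {x : M}
    (hx : x ∈ (𝓡∂ n).interior M) {t : ℝ} (ht : t ∈ Ioo 0 T) :
    HasDerivAt (fun s => u x s) (ut T u x t) t := by
  have hG : DifferentiableAt ℝ (chartFn u x) (extChartAt (𝓡∂ n) x x, t) :=
    (hu.contDiffAt hx ht).differentiableAt (by exact_mod_cast (by omega : k ≠ 0))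
  rw [ut_eq_timeD (mem_extChartAt_source x) ht hG]
  refine (AugHess.hasDerivAt_time hG).congr_of_eventuallyEq (Eventually.of_forall fun s => ?_)
  exact (chartFn_self u x s).symm

/-- In the chart, `u_t` is the time derivative of the coordinate expression of `u`. -/
theorem IsCk.eventually_ut_eq (hk : 1 ≤ k) (hu : IsCk n k T u) {x : M}
    (hx : x ∈ (𝓡∂ n).interior M) {t : ℝ} (ht : t ∈ Ioo 0 T) :
    ∀ᶠ q in 𝓝 (extChartAt (𝓡∂ n) x x, t),
      chartFn (ut T u) x q = timeD (chartFn u x) q := by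
  have h1 : ContDiffAt ℝ 1 (chartFn u x) (extChartAt (𝓡∂ n) x x, t) :=
    (hu.contDiffAt hx ht).of_le (by exact_mod_cast hk)
  have h2 : ∀ᶠ q in 𝓝 (extChartAt (𝓡∂ n) x x, t),
      q ∈ (extChartAt (𝓡∂ n) x).target ×ˢ Ioo 0 T :=
    prod_mem_nhds (target_mem_nhds hx) (Ioo_mem_nhds ht.1 ht.2)
  filter_upwards [h1.eventually_differentiableAt, h2] with q hd hq
  have h3 := (extChartAt (𝓡∂ n) x).right_inv hq.1
  have h4 := ut_eq_timeD (u := u) ((extChartAt (𝓡∂ n) x).map_target hq.1) hq.2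
    (by rw [h3]; exact hd)
  rw [h3] at h4
  exact h4

theorem IsCk.contDiffAt_ut (hk : 3 ≤ k) (hu : IsCk n k T u) {x : M}
    (hx : x ∈ (𝓡∂ n).interior M) {t : ℝ} (ht : t ∈ Ioo 0 T) :
    ContDiffAt ℝ 2 (chartFn (ut T u) x) (extChartAt (𝓡∂ n) x x, t) := by
  have h1 : ContDiffAt ℝ 3 (chartFn u x) (extChartAt (𝓡∂ n) x x, t) :=
    (hu.contDiffAt hx ht).of_le (by exact_mod_cast hk)
  exact (contDiffAt_fderiv_apply h1 (by norm_num) (0, 1)).congr_of_eventuallyEq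
    (hu.eventually_ut_eq (by omega) hx ht)

theorem IsCk.du_ut_eq (hk : 3 ≤ k) (hu : IsCk n k T u) {x : M}
    (hx : x ∈ (𝓡∂ n).interior M) {t : ℝ} (ht : t ∈ Ioo 0 T) :
    du n (ut T u) x t =
    fderiv ℝ (fun y => chartFn (ut T u) x (y, t)) (extChartAt (𝓡∂ n) x x) := by
  have h1 : MDifferentiableAt (𝓡∂ n) 𝓘(ℝ, ℝ) (fun y => ut T u y t) x := by
    rw [mdifferentiableAt_iff]
    constructor
    · have h2 := continuousOn_ut (by omega : 1 ≤ k) (ht.1.trans ht.2) hu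
      have h3 := h2.comp (f := fun y : M => (y, t)) (s := univ) (by fun_prop)
        fun y _ => ⟨mem_univ _, Ioo_subset_Icc_self ht⟩
      exact (continuousOn_univ.1 h3).continuousAt
    · have h2 : DifferentiableAt ℝ (fun y => chartFn (ut T u) x (y, t)) (extChartAt (𝓡∂ n) x x) :=
        ((hu.contDiffAt_ut hk hx ht).differentiableAt two_ne_zero).comp (f := fun y => (y, t)) _
          (hasFDerivAt_prodMk_left _ t).differentiableAt
      exact h2.differentiableWithinAt
  exact h1.mfderiv.trans (fderivWithin_of_mem_nhds (range_mem_nhds hx))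

theorem IsCk.hess_ut_eq (hk : 3 ≤ k) (hu : IsCk n k T u) {x : M}
    (hx : x ∈ (𝓡∂ n).interior M) {t : ℝ} (ht : t ∈ Ioo 0 T)
    (g : Metric n M) (v w : EE n) :
    hess g (ut T u) x t v w =
      fderiv ℝ (fun z => fderiv ℝ (fun z => chartFn (ut T u) x (z, t)) z)
        (extChartAt (𝓡∂ n) x x) v w -
      christoffelCov g x v w
        (fderiv ℝ (fun z => chartFn (ut T u) x (z, t)) (extChartAt (𝓡∂ n) x x)) := by
  rw [← hu.du_ut_eq hk hx ht]
  change coordD2 n (fun y => ut T u y t) x v w -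
    christoffelTerm g x (sharp g x (du n (ut T u) x t)) v w = _
  rw [coordD2_eq _ hx]
  rfl

theorem IsCk.hasDerivAt_du (hk : 3 ≤ k) (hu : IsCk n k T u) {x : M}
    (hx : x ∈ (𝓡∂ n).interior M) {t : ℝ} (ht : t ∈ Ioo 0 T) :
    HasDerivAt (fun s => (du n u x s : EE n →L[ℝ] ℝ))
    (du n (ut T u) x t : EE n →L[ℝ] ℝ) t := by
  have h1 : ContDiffAt ℝ 2 (chartFn u x) (extChartAt (𝓡∂ n) x x, t) :=
    (hu.contDiffAt hx ht).of_le (by exact_mod_cast (by omega : 2 ≤ k))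
  have h2 := hasDerivAt_fderiv_slice h1
  have h3 : fderiv ℝ (fun z => timeD (chartFn u x) (z, t)) (extChartAt (𝓡∂ n) x x) =
      du n (ut T u) x t := by
    rw [hu.du_ut_eq hk hx ht]
    have h4 : (fun z => chartFn (ut T u) x (z, t)) =ᶠ[𝓝 (extChartAt (𝓡∂ n) x x)]
        fun z => timeD (chartFn u x) (z, t) :=
      (tendsto_slice_space _ t).eventually (hu.eventually_ut_eq (by omega) hx ht)
    exact h4.fderiv_eq.symm
  rw [h3] at h2
  refine h2.congr_of_eventuallyEq ?_
  filter_upwards [Icc_mem_nhds ht.1 ht.2] with s hs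
  exact du_eq (by omega) hu hx hs

theorem IsCk.hasDerivAt_hess (hk : 3 ≤ k) (hu : IsCk n k T u) {x : M}
    (hx : x ∈ (𝓡∂ n).interior M) {t : ℝ} (ht : t ∈ Ioo 0 T)
    (g : Metric n M) (v w : EE n) :
    HasDerivAt (fun s => hess g u x s v w) (hess g (ut T u) x t v w) t := by
  have h1 : ContDiffAt ℝ 3 (chartFn u x) (extChartAt (𝓡∂ n) x x, t) :=
    (hu.contDiffAt hx ht).of_le (by exact_mod_cast hk)
  have h2 : (fun z => chartFn (ut T u) x (z, t)) =ᶠ[𝓝 (extChartAt (𝓡∂ n) x x)]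
      fun z => timeD (chartFn u x) (z, t) :=
    (tendsto_slice_space _ t).eventually (hu.eventually_ut_eq (by omega) hx ht)
  have h3 := hasDerivAt_fderiv_fderiv_slice h1 v w
  rw [← h2.fderiv.fderiv_eq] at h3
  have h4 := h3.sub ((christoffelCov g x v w).hasFDerivAt.comp_hasDerivAt t
    (hu.hasDerivAt_du hk hx ht))
  rw [hu.hess_ut_eq hk hx ht, ← hu.du_ut_eq hk hx ht]
  refine h4.congr_of_eventuallyEq ?_
  filter_upwards [Icc_mem_nhds ht.1 ht.2] with s hs
  rw [hess_eq (by omega) hu hx hs, ← du_eq (by omega) hu hx hs]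
  rfl

theorem IsCk.hasDerivAt_ut (hk : 3 ≤ k) (hu : IsCk n k T u) {x : M}
    (hx : x ∈ (𝓡∂ n).interior M) {t : ℝ} (ht : t ∈ Ioo 0 T) :
    HasDerivAt (fun s => ut T u x s) (ut T (ut T u) x t) t := by
  have h1 := (hu.contDiffAt_ut hk hx ht).differentiableAt two_ne_zero
  rw [ut_eq_timeD (mem_extChartAt_source x) ht h1]
  refine (AugHess.hasDerivAt_time h1).congr_of_eventuallyEq (Eventually.of_forall fun s => ?_)
  exact (chartFn_self (ut T u) x s).symm

end TimeDerivative

/-! ### The linearized equation -/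

section Linearized

variable {n : ℕ} [NeZero n] {M : Type*} [TopologicalSpace M]
  [ChartedSpace (EuclideanHalfSpace n) M] [IsManifold (𝓡∂ n) ∞ M] {g : Metric n M} {T : ℝ}
  {A : (x : M) → ℝ → Cot n x → Form n x} {Γ : Set (Fin (n + 1) → ℝ)}
  {f : (Fin (n + 1) → ℝ) → ℝ} {ψ : (x : M) → ℝ → Cot n x → ℝ} {φ u : M → ℝ → ℝ}

/-- The differential in `(t, p)` of `ψ (x, t, p)` at fixed `x`. -/
noncomputable def fiberD (ψ : (x : M) → ℝ → Cot n x → ℝ) (x : M) (t : ℝ) (p : EE n →L[ℝ] ℝ) :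
    ℝ × (EE n →L[ℝ] ℝ) →L[ℝ] ℝ :=
  fderiv ℝ (fun q : ℝ × (EE n →L[ℝ] ℝ) => ψ x q.1 q.2) (t, p)

/-- The differential in `(t, p)` of `A (x, t, p)(v, w)` at fixed `x`, `v`, `w`. -/
noncomputable def fiberDTensor (A : (x : M) → ℝ → Cot n x → Form n x) (x : M) (t : ℝ)
    (p : EE n →L[ℝ] ℝ) (v w : TangentSpace (𝓡∂ n) x) : ℝ × (EE n →L[ℝ] ℝ) →L[ℝ] ℝ :=
  fderiv ℝ (fun q : ℝ × (EE n →L[ℝ] ℝ) => A x q.1 q.2 v w) (t, p)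

theorem IsSmoothFun.hasFDerivAt_fiber (hψ : IsSmoothFun T ψ) (x : M) {t : ℝ} (ht : t ∈ Ioo 0 T)
    (p : EE n →L[ℝ] ℝ) : HasFDerivAt (fun q : ℝ × (EE n →L[ℝ] ℝ) => ψ x q.1 q.2)
      (fiberD ψ x t p) (t, p) :=
  (((hψ.contDiffOn_fiber x).contDiffAt
    (prod_mem_nhds (Icc_mem_nhds ht.1 ht.2) univ_mem)).differentiableAt (by simp)).hasFDerivAt

theorem IsSmoothTensor.hasFDerivAt_fiber (hA : IsSmoothTensor T A) (x : M) {t : ℝ}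
    (ht : t ∈ Ioo 0 T) (p : EE n →L[ℝ] ℝ) (v w : TangentSpace (𝓡∂ n) x) :
    HasFDerivAt (fun q : ℝ × (EE n →L[ℝ] ℝ) => A x q.1 q.2 v w)
      (fiberDTensor A x t p v w) (t, p) :=
  (((hA.contDiffOn_fiber x v w).contDiffAt
    (prod_mem_nhds (Icc_mem_nhds ht.1 ht.2) univ_mem)).differentiableAt (by simp)).hasFDerivAt

/-- The time derivative of the equation. Since the spectrum need not be differentiable, `f` of the
spectrum is compared with `f` of the diagonal in the eigenframe at time `t`, and then, by
concavity, with an affine function; all three agree at time `t`, and an extremum of the difference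
gives the equality of derivatives. -/
theorem IsSolution.time_derivative (hf : IsStructure Γ f) (hA : IsSmoothTensor T A)
    (hA_symm : ∀ x : M, ∀ t ∈ Icc 0 T, ∀ p v w, A x t p v w = A x t p w v)
    (hψ : IsSmoothFun T ψ) (hu : IsSolution g T A Γ f ψ φ u) {x : M}
    (hx : x ∈ (𝓡∂ n).interior M) {t : ℝ} (ht : t ∈ Ioo 0 T)
    (e : Module.Basis (Fin n) ℝ (TangentSpace (𝓡∂ n) x))
    (he : ∀ i j, g.inner x (e i) (e j) = if i = j then 1 else 0)
    (hdiag : diagPt g T A u x e t = spec g T A u x t) :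
    ∑ i : Fin n, (hess g (ut T u) x t (e i) (e i) +
          fiberDTensor A x t (du n u x t) (e i) (e i) (1, du n (ut T u) x t)) *
        fderiv ℝ f (spec g T A u x t) (Pi.single i.castSucc 1) -
      ut T (ut T u) x t * fderiv ℝ f (spec g T A u x t) (Pi.single (Fin.last n) 1) =
      fiberD ψ x t (du n u x t) (1, du n (ut T u) x t) := by
  have ht' := Ioo_subset_Icc_self ht
  have hIoo : ∀ᶠ s in 𝓝 t, s ∈ Ioo 0 T := Ioo_mem_nhds ht.1 ht.2
  obtain ⟨P, hP⟩ : ∃ P : ℝ → EE n →L[ℝ] ℝ, ∀ s, du n u x s = P s := ⟨_, fun _ => rfl⟩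
  obtain ⟨q, hq⟩ : ∃ q : EE n →L[ℝ] ℝ, du n (ut T u) x t = q := ⟨_, rfl⟩
  have hPd : HasDerivAt P q t := by
    have h := hu.isC3.hasDerivAt_du le_rfl hx ht
    rw [hq] at h
    exact h.congr_of_eventuallyEq (Eventually.of_forall fun s => (hP s).symm)
  rw [hP, hq]
  have hcurve : HasDerivAt (fun s => (s, P s)) ((1 : ℝ), q) t := (hasDerivAt_id t).prodMk hPd
  have hψd : HasDerivAt (fun s => ψ x s (P s)) (fiberD ψ x t (P t) (1, q)) t :=
    (hψ.hasFDerivAt_fiber x ht (P t)).comp_hasDerivAt (f := fun s => (s, P s)) t hcurve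
  have hAd : ∀ i, HasDerivAt (fun s => A x s (P s) (e i) (e i))
      (fiberDTensor A x t (P t) (e i) (e i) (1, q)) t := fun i =>
    (hA.hasFDerivAt_fiber x ht (P t) (e i) (e i)).comp_hasDerivAt (f := fun s => (s, P s)) t hcurve
  have hUd : ∀ i, HasDerivAt (fun s => augHess g A u x s (e i) (e i))
      (hess g (ut T u) x t (e i) (e i) + fiberDTensor A x t (P t) (e i) (e i) (1, q)) t :=
    fun i => ((hu.isC3.hasDerivAt_hess le_rfl hx ht g (e i) (e i)).add
      (hAd i)).congr_of_eventuallyEq (Eventually.of_forall fun s => by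
        change hess g u x s (e i) (e i) + A x s (du n u x s) (e i) (e i) = _
        rw [hP]
        rfl)
  have hzd : HasDerivAt (diagPt g T A u x e) (Fin.snoc (α := fun _ => ℝ) (fun i =>
      hess g (ut T u) x t (e i) (e i) + fiberDTensor A x t (P t) (e i) (e i) (1, q))
      (-ut T (ut T u) x t)) t := by
    rw [hasDerivAt_pi]
    intro i
    refine Fin.lastCases ?_ (fun i => ?_) i
    · simp only [diagPt, Fin.snoc_last]
      exact (hu.isC3.hasDerivAt_ut le_rfl hx ht).neg
    · simp only [diagPt, Fin.snoc_castSucc]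
      exact hUd i
  have hzd' := (fderiv ℝ f (spec g T A u x t)).hasFDerivAt.comp_hasDerivAt t hzd
  have hmem : ∀ s ∈ Icc 0 T, spec g T A u x s ∈ Γ := fun s hs => hu.admissible x hx s hs
  have hcmp : ∀ s ∈ Ioo 0 T, ψ x s (P s) ≤ f (spec g T A u x t) +
      fderiv ℝ f (spec g T A u x t) (diagPt g T A u x e s - spec g T A u x t) := by
    intro s hs
    have hs' := Ioo_subset_Icc_self hs
    have hz : (Fin.snoc (α := fun _ => ℝ) (fun _ : Fin n => (0 : ℝ)) 0 : Fin (n + 1) → ℝ) = 0 := by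
      ext i
      refine Fin.lastCases ?_ (fun i => ?_) i <;> simp
    have h1 := le_diagPt hf hA_symm (by norm_num) hu.isC3 hx hs e he 0 0
      (by rw [hz, add_zero]; exact hmem s hs')
    rw [hz, add_zero, add_zero] at h1
    have h2 := hf.le_add_fderiv (hmem t ht') h1.1
    have h3 := hu.eqn x hx s ⟨hs.1, hs.2.le⟩
    rw [hP] at h3
    exact h3.symm.le.trans (h1.2.trans h2)
  have hmin : IsLocalMin (fun s => fderiv ℝ f (spec g T A u x t) (diagPt g T A u x e s) -
      ψ x s (P s)) t := by
    filter_upwards [hIoo] with s hs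
    have h1 := hcmp s hs
    have h3 := hu.eqn x hx t ⟨ht.1, ht.2.le⟩
    rw [hP] at h3
    rw [map_sub, h3] at h1
    rw [hdiag]
    linarith
  have h0 := hmin.hasDerivAt_eq_zero (hzd'.sub hψd)
  rw [fderiv_eq_sum, Fin.sum_univ_castSucc] at h0
  simp only [Fin.snoc_castSucc, Fin.snoc_last] at h0
  linarith

end Linearized

/-! ### The maximum principle -/

theorem fderiv_fderiv_sub_const {E : Type*} [NormedAddCommGroup E] [NormedSpace ℝ E]
    {h₁ h₂ : E → ℝ} {y : E} (hh₁ : ContDiffAt ℝ 2 h₁ y) (hh₂ : ContDiffAt ℝ 2 h₂ y) (r : ℝ) :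
    fderiv ℝ (fun z => h₁ z - h₂ z - r) y = fderiv ℝ h₁ y - fderiv ℝ h₂ y ∧
    fderiv ℝ (fun z => fderiv ℝ (fun z => h₁ z - h₂ z - r) z) y =
      fderiv ℝ (fun z => fderiv ℝ h₁ z) y - fderiv ℝ (fun z => fderiv ℝ h₂ z) y := by
  have h12 : (1 : WithTop ℕ∞) ≤ 2 := by norm_num
  have hev : (fun z => fderiv ℝ (fun z => h₁ z - h₂ z - r) z) =ᶠ[𝓝 y]
      fun z => fderiv ℝ h₁ z - fderiv ℝ h₂ z := by
    filter_upwards [(hh₁.of_le h12).eventually_differentiableAt,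
      (hh₂.of_le h12).eventually_differentiableAt] with z hz₁ hz₂
    exact ((hz₁.hasFDerivAt.sub hz₂.hasFDerivAt).sub_const r).fderiv
  refine ⟨hev.self_of_nhds, ?_⟩
  rw [hev.fderiv_eq]
  exact (((hh₁.fderiv_right (m := 1) (by norm_num)).differentiableAt one_ne_zero).hasFDerivAt.sub
    ((hh₂.fderiv_right (m := 1) (by norm_num)).differentiableAt one_ne_zero).hasFDerivAt).fderiv

section MaximumPrinciple

variable {n : ℕ} [NeZero n] {M : Type*} [TopologicalSpace M]
  [ChartedSpace (EuclideanHalfSpace n) M] [IsManifold (𝓡∂ n) ∞ M] {g : Metric n M} {T : ℝ}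
  {A : (x : M) → ℝ → Cot n x → Form n x} {Γ : Set (Fin (n + 1) → ℝ)}
  {f : (Fin (n + 1) → ℝ) → ℝ} {ψ : (x : M) → ℝ → Cot n x → ℝ} {φ u v : M → ℝ → ℝ}

/-- First and second order conditions at an interior maximum of `σ u_t + a exp (k (v - u - t))`. -/
theorem conditions_of_isMax {σ a k : ℝ} (hu : IsCk n 3 T u) (hv : IsCk n 2 T v) {x : M}
    (hx : x ∈ (𝓡∂ n).interior M) {t S : ℝ} (ht : t ∈ Ioo 0 T) (htS : t ≤ S)
    (hmax : ∀ z : M, ∀ s ∈ Icc 0 S,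
      σ * ut T u z s + a * Real.exp (k * (v z s - u z s - s)) ≤
        σ * ut T u x t + a * Real.exp (k * (v x t - u x t - t)))
    {E : ℝ} (hE : E = a * k * Real.exp (k * (v x t - u x t - t))) :
    (∀ w, σ * du n (ut T u) x t w + E * (du n v x t w - du n u x t w) = 0) ∧
    (∀ w, σ * hess g (ut T u) x t w w + E * (hess g v x t w w - hess g u x t w w +
      k * (du n v x t w - du n u x t w) ^ 2) ≤ 0) ∧
    0 ≤ σ * ut T (ut T u) x t + E * (ut T v x t - ut T u x t - 1) := by
  have ht' := Ioo_subset_Icc_self ht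
  set y : EE n := extChartAt (𝓡∂ n) x x with hy
  have hslice : ContDiffAt ℝ 2 (fun z : EE n => (z, t)) y := contDiffAt_id.prodMk contDiffAt_const
  have hw2 : ContDiffAt ℝ 2 (fun z => chartFn (ut T u) x (z, t)) y :=
    (hu.contDiffAt_ut le_rfl hx ht).comp (f := fun z => (z, t)) y hslice
  have hu2 : ContDiffAt ℝ 2 (fun z => chartFn u x (z, t)) y :=
    ((hu.contDiffAt hx ht).of_le (by norm_num)).comp (f := fun z => (z, t)) y hslice
  have hv2 : ContDiffAt ℝ 2 (fun z => chartFn v x (z, t)) y :=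
    (hv.contDiffAt hx ht).comp (f := fun z => (z, t)) y hslice
  obtain ⟨hD1, hD2⟩ := fderiv_fderiv_sub_const hv2 hu2 t
  have hloc : IsLocalMax (fun z => σ * chartFn (ut T u) x (z, t) +
      a * Real.exp (k * (chartFn v x (z, t) - chartFn u x (z, t) - t))) y := by
    refine Eventually.of_forall fun z => ?_
    simp only [hy, chartFn_self]
    exact hmax _ t ⟨ht.1.le, htS⟩
  obtain ⟨h1, h2⟩ := isLocalMax_add_exp hw2 ((hv2.sub hu2).sub contDiffAt_const) σ a k hloc
  simp only [hD1, hD2] at h1 h2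
  simp only [hy, chartFn_self, ← hE] at h1 h2
  rw [← hu.du_ut_eq le_rfl hx ht, ← du_eq (by norm_num) hu hx ht',
    ← du_eq (by norm_num) hv hx ht'] at h1
  rw [← du_eq (by norm_num) hu hx ht', ← du_eq (by norm_num) hv hx ht'] at h2
  refine ⟨h1, fun w => ?_, ?_⟩
  · -- by the first order condition the Christoffel terms cancel
    have h3 := h2 w
    have h4 : ∀ q p' p : EE n →L[ℝ] ℝ, (∀ w, σ * q w + E * (p' w - p w) = 0) →
        σ * christoffelCov g x w w q +
          E * (christoffelCov g x w w p' - christoffelCov g x w w p) = 0 := by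
      intro q p' p h
      have h5 : σ • q + E • (p' - p) = 0 := ContinuousLinearMap.ext h
      simpa using congrArg (christoffelCov g x w w) h5
    have h5 := h4 _ _ _ h1
    have e1 := hu.hess_ut_eq le_rfl hx ht g w w
    have e2 := hess_eq (g := g) (by norm_num) hu hx ht' w w
    have e3 := hess_eq (g := g) (by norm_num) hv hx ht' w w
    rw [← hu.du_ut_eq le_rfl hx ht] at e1
    rw [← du_eq (by norm_num) hu hx ht'] at e2
    rw [← du_eq (by norm_num) hv hx ht'] at e3
    change σ * _ + E * (fderiv ℝ (fun z => fderiv ℝ (fun z => chartFn v x (z, t)) z) y w w -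
      fderiv ℝ (fun z => fderiv ℝ (fun z => chartFn u x (z, t)) z) y w w +
      k * (du n v x t w - du n u x t w) ^ 2) ≤ 0 at h3
    rw [hy] at h3
    linear_combination h3 - h5 + σ * e1 + E * (e3 - e2)
  · have h4 := ((hu.hasDerivAt_ut le_rfl hx ht).const_mul σ).add
      (((((hv.hasDerivAt_time (by norm_num) hx ht).sub
        (hu.hasDerivAt_time (by norm_num) hx ht)).sub
        (hasDerivAt_id t)).const_mul k).exp.const_mul a)
    have h5 := deriv_nonneg_of_isMaxOn_Icc ht.1 htS (fun s hs => hmax x s hs) h4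
    refine h5.trans_eq ?_
    simp only [Pi.sub_apply, id_eq, hE]
    ring

/-- The barrier inequality: up to the error of regularity, the linearized operator applied to
`v - u - t` is at least `c + δ ∑ fᵢ`. -/
theorem barrier_le {K : Set (Fin (n + 1) → ℝ)} {c δ : ℝ} (hf : IsStructure Γ f)
    (hA_symm : ∀ x : M, ∀ t ∈ Icc 0 T, ∀ p v w, A x t p v w = A x t p w v)
    (hgain : ∀ μ ∈ K, (μ + Pi.single (Fin.last n) 1 - fun _ => δ) ∈ Γ ∧
      f μ + c ≤ f (μ + Pi.single (Fin.last n) 1 - fun _ => δ))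
    (hψ : IsSmoothFun T ψ) (hψ_conv : ∀ x : M, ∀ t ∈ Icc 0 T, ConvexOn ℝ univ (ψ x t))
    (hv : IsSubsolution g T A Γ f ψ φ v)
    (hvK : ∀ x ∈ (𝓡∂ n).interior M, ∀ t ∈ Icc 0 T, spec g T A v x t ∈ K)
    (hu : IsSolution g T A Γ f ψ φ u) {x : M} (hx : x ∈ (𝓡∂ n).interior M) {t : ℝ}
    (ht : t ∈ Ioo 0 T) (e : Module.Basis (Fin n) ℝ (TangentSpace (𝓡∂ n) x))
    (he : ∀ i j, g.inner x (e i) (e j) = if i = j then 1 else 0)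
    (hdiag : diagPt g T A u x e t = spec g T A u x t) {p p' : EE n →L[ℝ] ℝ}
    (hp : du n u x t = p) (hp' : du n v x t = p') :
    fiberD ψ x t p (0, p' - p) + c ≤
      ∑ i : Fin n, (augHess g A v x t (e i) (e i) - δ - augHess g A u x t (e i) (e i)) *
        fderiv ℝ f (spec g T A u x t) (Pi.single i.castSucc 1) +
      (ut T u x t - ut T v x t + 1 - δ) *
        fderiv ℝ f (spec g T A u x t) (Pi.single (Fin.last n) 1) := by
  have ht' := Ioo_subset_Icc_self ht
  have hψconv : ψ x t p + fiberD ψ x t p (0, p' - p) ≤ ψ x t p' := by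
    have h1 : HasFDerivAt (fun q : EE n →L[ℝ] ℝ => ψ x t q)
        ((fiberD ψ x t p).comp (ContinuousLinearMap.inr ℝ ℝ (EE n →L[ℝ] ℝ))) p :=
      (hψ.hasFDerivAt_fiber x ht p).comp (f := fun q => (t, q)) p (hasFDerivAt_prodMk_right t p)
    have h2 : ConvexOn ℝ univ (fun q : EE n →L[ℝ] ℝ => ψ x t q) := hψ_conv x t ht'
    exact h2.add_le_of_hasFDerivAt (mem_univ p) (mem_univ p') h1
  have hshift : ∀ z : Fin (n + 1) → ℝ, (z + Pi.single (Fin.last n) 1 - fun _ => δ) =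
      z + Fin.snoc (α := fun _ => ℝ) (fun _ : Fin n => -δ) (1 - δ) := by
    intro z
    ext i
    refine Fin.lastCases ?_ (fun i => ?_) i
    · simp; ring
    · simp [Fin.castSucc_ne_last]; ring
  obtain ⟨h1, h2⟩ := hgain _ (hvK x hx t ht')
  rw [hshift] at h1 h2
  have h3 := le_diagPt hf hA_symm (by norm_num) hv.isC2 hx ht e he (-δ) (1 - δ) h1
  have h4 := hf.le_add_fderiv (hu.admissible x hx t ht') h3.1
  have h5 := hv.ineq x hx t ht'
  have h6 := hu.eqn x hx t ⟨ht.1, ht.2.le⟩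
  rw [hp'] at h5
  rw [hp] at h6
  have h7 : diagPt g T A v x e t + Fin.snoc (α := fun _ => ℝ) (fun _ : Fin n => -δ) (1 - δ) -
      spec g T A u x t = Fin.snoc (α := fun _ => ℝ)
        (fun i => augHess g A v x t (e i) (e i) - δ - augHess g A u x t (e i) (e i))
        (ut T u x t - ut T v x t + 1 - δ) := by
    rw [← hdiag]
    ext i
    refine Fin.lastCases ?_ (fun i => ?_) i
    · simp [diagPt]; ring
    · simp [diagPt]; ring
  rw [h7, fderiv_eq_sum, Fin.sum_univ_castSucc] at h4
  simp only [Fin.snoc_castSucc, Fin.snoc_last] at h4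
  linarith [h3.2]

/-- Young's inequality, in the form that absorbs the error of regularity into the square that the
exponential produces. -/
theorem two_mul_abs_le {C δ k s : ℝ} (hδ : 0 < δ) (hk : 2 * C ^ 2 / δ ≤ k) :
    2 * C * |s| ≤ δ / 2 + k * s ^ 2 := by
  have h1 : 2 * C ^ 2 / δ * s ^ 2 ≤ k * s ^ 2 := by gcongr
  have h2 : δ / 2 + 2 * C ^ 2 / δ * s ^ 2 - 2 * C * |s| = (δ - 2 * C * |s|) ^ 2 / (2 * δ) := by
    field_simp
    rw [← sq_abs s]
    ring
  have h3 : 0 ≤ (δ - 2 * C * |s|) ^ 2 / (2 * δ) := by positivity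
  linarith

/-- The function `± u_t + a exp (k (v - u - t))` has no maximum at an interior point, if `v` is a
subsolution and the constants `k`, `a` are large. -/
theorem not_isMax_of_interior {𝒜 : FiniteAtlas n M} (hT : 0 < T) (hf : IsStructure Γ f)
    (hA : IsSmoothTensor T A)
    (hA_symm : ∀ x : M, ∀ t ∈ Icc 0 T, ∀ p v w, A x t p v w = A x t p w v)
    (hA_reg : IsRegular T (fun x t p => -A x t p)) {K : Set (Fin (n + 1) → ℝ)} {c δ C B k a σ : ℝ}
    (hδ : 0 < δ) (hC0 : 0 ≤ C) (hk : 2 * C ^ 2 / δ ≤ k)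
    (hgain : ∀ μ ∈ K, (μ + Pi.single (Fin.last n) 1 - fun _ => δ) ∈ Γ ∧
      f μ + c ≤ f (μ + Pi.single (Fin.last n) 1 - fun _ => δ))
    (hC : ∀ x : M, ∀ t ∈ Icc 0 T, ∀ t' ∈ Icc 0 T, ∀ p p' : Cot n x, ∀ r : ℝ,
      ∀ e : TangentSpace (𝓡∂ n) x, CovBdd g x (7 * B + 1) p → CovBdd g x (7 * B + 1) p' →
      CovBdd g x r (p - p') → g.inner x e e ≤ 1 →
      |A x t p e e - A x t' p' e e| ≤ C * (|t - t'| + r))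
    (hψ : IsSmoothFun T ψ) (hψ_conv : ∀ x : M, ∀ t ∈ Icc 0 T, ConvexOn ℝ univ (ψ x t))
    (hψ_bdd : C2Bound 𝒜 g T B ψ) (hv : IsSubsolution g T A Γ f ψ φ v)
    (hvK : ∀ x ∈ (𝓡∂ n).interior M, ∀ t ∈ Icc 0 T, spec g T A v x t ∈ K)
    (hu : IsSolution g T A Γ f ψ φ u) {x : M} (hx : x ∈ (𝓡∂ n).interior M) {t S : ℝ}
    (ht : t ∈ Ioo 0 T) (htS : t ≤ S)
    (hub : covNorm g x (du n u x t) ≤ B) (hvb : covNorm g x (du n v x t) ≤ B)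
    (hσ : |σ| = 1)
    (hEpos : 0 < a * k * Real.exp (k * (v x t - u x t - t)))
    (hEc : B < a * k * Real.exp (k * (v x t - u x t - t)) * c)
    (hEδ : C ≤ a * k * Real.exp (k * (v x t - u x t - t)) * (δ / 2))
    (hmax : ∀ z : M, ∀ s ∈ Icc 0 S,
      σ * ut T u z s + a * Real.exp (k * (v z s - u z s - s)) ≤
        σ * ut T u x t + a * Real.exp (k * (v x t - u x t - t))) : False := by
  have ht' := Ioo_subset_Icc_self ht
  obtain ⟨e, he, hUe⟩ := isEigenvalues_augHess (g := g) hA_symm (by norm_num) hu.isC3 hx ht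
  have hdiag : diagPt g T A u x e t = spec g T A u x t := by
    ext i
    refine Fin.lastCases ?_ (fun i => ?_) i
    · simp [diagPt, spec]
    · simpa [diagPt, spec, augHess] using hUe i i
  have hee : ∀ i, g.inner x (e i) (e i) = 1 := fun i => by rw [he, if_pos rfl]
  obtain ⟨E, hE⟩ : ∃ E, E = a * k * Real.exp (k * (v x t - u x t - t)) := ⟨_, rfl⟩
  rw [← hE] at hEpos hEc hEδ
  obtain ⟨hfirst, hsecond, htime⟩ := conditions_of_isMax (g := g) hu.isC3 hv.isC2 hx ht htS hmax hE
  have hTD := hu.time_derivative hf hA hA_symm hψ hx ht e he hdiag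
  obtain ⟨p, hp⟩ : ∃ p : EE n →L[ℝ] ℝ, du n u x t = p := ⟨_, rfl⟩
  obtain ⟨p', hp'⟩ : ∃ p' : EE n →L[ℝ] ℝ, du n v x t = p' := ⟨_, rfl⟩
  obtain ⟨q, hq⟩ : ∃ q : EE n →L[ℝ] ℝ, du n (ut T u) x t = q := ⟨_, rfl⟩
  have hbar := barrier_le hf hA_symm hgain hψ hψ_conv hv hvK hu hx ht e he hdiag hp hp'
  rw [hp, hp', hq] at hfirst
  rw [hp, hp'] at hsecond
  rw [hp, hq] at hTD
  rw [hp] at hub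
  rw [hp'] at hvb
  obtain ⟨η, hη⟩ : ∃ η : EE n →L[ℝ] ℝ, η = p' - p := ⟨_, rfl⟩
  have hηw : ∀ w, p' w - p w = η w := fun w => by rw [hη]; rfl
  rw [← hη] at hbar
  have hqη : σ • q = -(E • η) := by
    ext w
    have : σ * q w + E * (p' w - p w) = 0 := hfirst w
    rw [hηw] at this
    change σ * q w = -(E * η w)
    linarith
  have hFpos : ∀ j, 0 < fderiv ℝ f (spec g T A u x t) (Pi.single j 1) :=
    hf.f_mono _ (hu.admissible x hx t ht')
  have hsplit : ∀ L : ℝ × (EE n →L[ℝ] ℝ) →L[ℝ] ℝ,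
      σ * L (1, q) = σ * L (1, 0) - E * L (0, η) := fun L => by
    have h1 : L (1, q) = L (1, 0) + L (0, q) := by rw [← map_add]; simp
    have h2 : L (0, σ • q) = σ * L (0, q) := by
      rw [← smul_eq_mul, ← map_smul]; simp
    have h3 : L (0, -(E • η)) = -(E * L (0, η)) := by
      rw [← smul_eq_mul, ← map_smul, ← map_neg]; simp
    rw [hqη, h3] at h2
    rw [h1, mul_add, ← h2]
    ring
  have hσmul : ∀ {r b : ℝ}, |r| ≤ b → |σ * r| ≤ b := fun {r b} h => by
    rwa [abs_mul, hσ, one_mul]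
  have hline : HasDerivAt (fun s : ℝ => (s, p)) ((1 : ℝ), (0 : EE n →L[ℝ] ℝ)) t :=
    (hasDerivAt_id t).prodMk (hasDerivAt_const t p)
  have hpb : CovBdd g x B p := covBdd_of_covNorm_le g hub
  have hp'b : CovBdd g x B p' := covBdd_of_covNorm_le g hvb
  have hB := hpb.nonneg
  have hψt : |fiberD ψ x t p (1, 0)| ≤ B :=
    hψ_bdd.abs_deriv_time_le hT hψ ht (p := p) hub
      ((hψ.hasFDerivAt_fiber x ht p).comp_hasDerivAt (f := fun s => (s, p)) t hline)
  have hAt : ∀ i, |fiberDTensor A x t p (e i) (e i) (1, 0)| ≤ C := by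
    intro i
    have h2 : HasDerivAt (fun s => A x s p (e i) (e i))
        (fiberDTensor A x t p (e i) (e i) (1, 0)) t :=
      (hA.hasFDerivAt_fiber x ht p (e i) (e i)).comp_hasDerivAt (f := fun s => (s, p)) t hline
    refine h2.le_of_lip' hC0 ?_
    filter_upwards [Ioo_mem_nhds ht.1 ht.2] with s hs
    have hz : CovBdd g x 0 ((p : Cot n x) - p) := fun w _ => by
      rw [sub_self]
      exact abs_zero.le
    have := hC x s (Ioo_subset_Icc_self hs) t ht' p p 0 (e i) (hpb.mono (by linarith))
      (hpb.mono (by linarith)) hz (hee i).le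
    simpa using this
  have hAreg : ∀ i, A x t p' (e i) (e i) - A x t p (e i) (e i) ≤
      fiberDTensor A x t p (e i) (e i) (0, η) + 2 * C * |η (e i)| := by
    intro i
    have h1 : HasFDerivAt (fun q : EE n →L[ℝ] ℝ => A x t q (e i) (e i))
        ((fiberDTensor A x t p (e i) (e i)).comp
          (ContinuousLinearMap.inr ℝ ℝ (EE n →L[ℝ] ℝ))) p :=
      (hA.hasFDerivAt_fiber x ht p (e i) (e i)).comp (f := fun q => (t, q)) p
        (hasFDerivAt_prodMk_right t p)
    have hηb : CovBdd g x (2 * B) η := hη ▸ (hp'b.sub hpb).mono (by linarith)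
    have h2 := regular_le hA hA_reg ht' (g := g) (B := B) (C := C)
      (fun p p' r e h1 h2 h3 h4 => by simpa using hC x t ht' t ht' p p' r e h1 h2 h3 h4)
      (hee i) hpb hηb h1
    have h3 : p + η = p' := by rw [hη]; abel
    rw [h3] at h2
    have h4 : ((fiberDTensor A x t p (e i) (e i)).comp
      (ContinuousLinearMap.inr ℝ ℝ (EE n →L[ℝ] ℝ))) η =
        fiberDTensor A x t p (e i) (e i) (0, η) := rfl
    rw [h4] at h2
    linarith
  -- the contribution of each eigendirection is nonpositive
  have hdir : ∀ i, E * (augHess g A v x t (e i) (e i) - δ - augHess g A u x t (e i) (e i)) +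
      σ * (hess g (ut T u) x t (e i) (e i) +
        fiberDTensor A x t p (e i) (e i) (1, q)) ≤ 0 := by
    intro i
    have h1 : σ * hess g (ut T u) x t (e i) (e i) + E * (hess g v x t (e i) (e i) -
      hess g u x t (e i) (e i) + k * η (e i) ^ 2) ≤ 0 := by
      have h0 : p' (e i) - p (e i) = η (e i) := hηw (e i)
      rw [← h0]
      exact hsecond (e i)
    have h2 : ∀ w : M → ℝ → ℝ, augHess g A w x t (e i) (e i) =
      hess g w x t (e i) (e i) + A x t (du n w x t) (e i) (e i) := fun w => rfl
    have h3 := hAreg i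
    have h4 := (abs_le.1 (hσmul (hAt i))).2
    have h5 : 2 * C * |η (e i)| ≤ δ / 2 + k * η (e i) ^ 2 := two_mul_abs_le hδ hk
    have h6 : E * (A x t p' (e i) (e i) - A x t p (e i) (e i)) ≤
        E * (fiberDTensor A x t p (e i) (e i) (0, η) + (δ / 2 + k * η (e i) ^ 2)) :=
      mul_le_mul_of_nonneg_left (by linarith) hEpos.le
    rw [h2, h2, hp, hp', mul_add σ, hsplit]
    linarith
  have hlast : E * (ut T u x t - ut T v x t + 1 - δ) - σ * ut T (ut T u) x t ≤ 0 := by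
    have := mul_pos hEpos hδ
    linarith
  have hsum : ∑ i : Fin n,
      (E * (augHess g A v x t (e i) (e i) - δ - augHess g A u x t (e i) (e i)) +
        σ * (hess g (ut T u) x t (e i) (e i) + fiberDTensor A x t p (e i) (e i) (1, q))) *
      fderiv ℝ f (spec g T A u x t) (Pi.single i.castSucc 1) ≤ 0 :=
    Finset.sum_nonpos fun i _ => mul_nonpos_of_nonpos_of_nonneg (hdir i) (hFpos _).le
  have hlin : ∀ X Y F : Fin n → ℝ,
      ∑ i, (E * X i + σ * Y i) * F i = E * ∑ i, X i * F i + σ * ∑ i, Y i * F i := by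
    intro X Y F
    rw [Finset.mul_sum, Finset.mul_sum, ← Finset.sum_add_distrib]
    exact Finset.sum_congr rfl fun i _ => by ring
  rw [hlin] at hsum
  have hlast' := mul_nonpos_of_nonpos_of_nonneg hlast (hFpos (Fin.last n)).le
  have hbar' := mul_le_mul_of_nonneg_left hbar hEpos.le
  have hTD' := congrArg (σ * ·) hTD
  simp only [hsplit, mul_sub] at hTD'
  have hψσ := (abs_le.1 (hσmul hψt)).1
  linarith

end MaximumPrinciple

/-! ### The global estimate -/

section Estimate

variable {n : ℕ} [NeZero n] {M : Type*} [TopologicalSpace M]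
  [ChartedSpace (EuclideanHalfSpace n) M] [IsManifold (𝓡∂ n) ∞ M] {g : Metric n M} {T : ℝ}
  {A : (x : M) → ℝ → Cot n x → Form n x} {Γ : Set (Fin (n + 1) → ℝ)}
  {f : (Fin (n + 1) → ℝ) → ℝ} {ψ : (x : M) → ℝ → Cot n x → ℝ} {φ u v : M → ℝ → ℝ}

theorem SpaceC1Bound.bounds {B : ℝ} (h : SpaceC1Bound g T B u) {x : M} {t : ℝ} (ht : t ∈ Icc 0 T) :
    |u x t| ≤ B ∧ covNorm g x (du n u x t) ≤ B := by
  have h1 := h x t ht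
  have h2 := abs_nonneg (u x t)
  have h3 : 0 ≤ covNorm g x (du n u x t) := Real.sqrt_nonneg _
  constructor <;> linarith

theorem ParabolicC2Bound.spaceC1Bound {B : ℝ} (h : ParabolicC2Bound g T B u) :
    SpaceC1Bound g T B u := by
  intro x t ht
  have h1 := h x t ht 0
  have h2 := abs_nonneg (eigs g x (hess g u x t) 0)
  have h3 := abs_nonneg (ut T u x t)
  linarith

/-- Values of `|u_t|` on the parabolic boundary are bounded by their supremum, which is thus not
a junk value. -/
theorem abs_ut_le_sSup [CompactSpace M] (hT : 0 < T) (hu : IsCk n 3 T u) {q : M × ℝ}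
    (hq : q ∈ parabolicBoundary n M T) :
    |ut T u q.1 q.2| ≤
      sSup ((fun q : M × ℝ => |ut T u q.1 q.2|) '' parabolicBoundary n M T) := by
  refine le_csSup ?_ (mem_image_of_mem _ hq)
  have hsub : parabolicBoundary n M T ⊆ univ ×ˢ Icc 0 T := by
    rintro ⟨x, t⟩ (⟨-, rfl⟩ | ⟨-, ht⟩)
    · exact ⟨mem_univ _, left_mem_Icc.2 hT.le⟩
    · exact ⟨mem_univ _, ht⟩
  exact ((isCompact_univ.prod isCompact_Icc).bddAbove_image
    (continuousOn_ut (by norm_num) hT hu).abs).mono (image_mono hsub)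

/-- The estimate for `± u_t` on `[0, S]` with `S < T`: the maximum of
`± u_t + a exp (k (v - u - t))` is attained on the parabolic boundary. -/
theorem mul_ut_le [CompactSpace M] {𝒜 : FiniteAtlas n M} (hT : 0 < T) (hf : IsStructure Γ f)
    (hA : IsSmoothTensor T A)
    (hA_symm : ∀ x : M, ∀ t ∈ Icc 0 T, ∀ p v w, A x t p v w = A x t p w v)
    (hA_reg : IsRegular T (fun x t p => -A x t p)) {K : Set (Fin (n + 1) → ℝ)} {c δ C B k a σ : ℝ}
    (hc : 0 < c) (hδ : 0 < δ) (hC0 : 0 ≤ C) (hk0 : 0 < k) (ha : 0 < a) (hk : 2 * C ^ 2 / δ ≤ k)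
    (hgain : ∀ μ ∈ K, (μ + Pi.single (Fin.last n) 1 - fun _ => δ) ∈ Γ ∧
      f μ + c ≤ f (μ + Pi.single (Fin.last n) 1 - fun _ => δ))
    (hC : ∀ x : M, ∀ t ∈ Icc 0 T, ∀ t' ∈ Icc 0 T, ∀ p p' : Cot n x, ∀ r : ℝ,
      ∀ e : TangentSpace (𝓡∂ n) x, CovBdd g x (7 * B + 1) p → CovBdd g x (7 * B + 1) p' →
      CovBdd g x r (p - p') → g.inner x e e ≤ 1 →
      |A x t p e e - A x t' p' e e| ≤ C * (|t - t'| + r))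
    (hac : B < a * k * Real.exp (-(k * (2 * B + T))) * c)
    (haδ : C ≤ a * k * Real.exp (-(k * (2 * B + T))) * (δ / 2))
    (hψ : IsSmoothFun T ψ) (hψ_conv : ∀ x : M, ∀ t ∈ Icc 0 T, ConvexOn ℝ univ (ψ x t))
    (hψ_bdd : C2Bound 𝒜 g T B ψ) (hv : IsSubsolution g T A Γ f ψ φ v)
    (hvK : ∀ x ∈ (𝓡∂ n).interior M, ∀ t ∈ Icc 0 T, spec g T A v x t ∈ K)
    (hvB : SpaceC1Bound g T B v) (hu : IsSolution g T A Γ f ψ φ u) (huB : SpaceC1Bound g T B u)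
    (hσ : |σ| = 1) {S : ℝ} (hST : S < T) {x : M} {t : ℝ} (ht : t ∈ Icc 0 S) :
    σ * ut T u x t ≤ a * Real.exp (2 * k * B) +
      sSup ((fun q : M × ℝ => |ut T u q.1 q.2|) '' parabolicBoundary n M T) := by
  have hsub : (univ : Set M) ×ˢ Icc 0 S ⊆ univ ×ˢ Icc 0 T :=
    prod_mono Subset.rfl (Icc_subset_Icc_right hST.le)
  have hcont : ContinuousOn (fun q : M × ℝ => σ * ut T u q.1 q.2 +
      a * Real.exp (k * (v q.1 q.2 - u q.1 q.2 - q.2))) (univ ×ˢ Icc 0 S) := by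
    have h1 := (continuousOn_ut (by norm_num) hT hu.isC3).mono hsub
    have h2 := hu.isC3.continuousOn.mono hsub
    have h3 := hv.isC2.continuousOn.mono hsub
    fun_prop
  obtain ⟨⟨x₀, t₀⟩, ⟨-, ht₀⟩, hmax⟩ :=
    (isCompact_univ.prod isCompact_Icc).exists_isMaxOn ⟨(x, t), mem_univ _, ht⟩ hcont
  replace hmax : ∀ z : M, ∀ s ∈ Icc 0 S,
      σ * ut T u z s + a * Real.exp (k * (v z s - u z s - s)) ≤
        σ * ut T u x₀ t₀ + a * Real.exp (k * (v x₀ t₀ - u x₀ t₀ - t₀)) :=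
    fun z s hs => hmax (a := (z, s)) ⟨mem_univ z, hs⟩
  have ht₀T : t₀ ∈ Icc 0 T := ⟨ht₀.1, ht₀.2.trans hST.le⟩
  obtain ⟨hu₀, hdu₀⟩ := huB.bounds (x := x₀) ht₀T
  obtain ⟨hv₀, hdv₀⟩ := hvB.bounds (x := x₀) ht₀T
  rw [abs_le] at hu₀ hv₀
  have hbdry : (x₀, t₀) ∈ parabolicBoundary n M T := by
    rcases (𝓡∂ n).isInteriorPoint_or_isBoundaryPoint x₀ with hx₀ | hx₀
    · rcases ht₀.1.eq_or_lt with h0 | h0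
      · exact Or.inl ⟨hx₀, h0.symm⟩
      · exfalso
        have hexp : a * k * Real.exp (-(k * (2 * B + T))) ≤
            a * k * Real.exp (k * (v x₀ t₀ - u x₀ t₀ - t₀)) := by
          have : -(k * (2 * B + T)) ≤ k * (v x₀ t₀ - u x₀ t₀ - t₀) := by
            rw [← mul_neg]
            exact mul_le_mul_of_nonneg_left (by linarith [ht₀T.2]) hk0.le
          gcongr
        exact not_isMax_of_interior hT hf hA hA_symm hA_reg hδ hC0 hk hgain hC hψ hψ_conv hψ_bdd
          hv hvK hu hx₀ ⟨h0, ht₀.2.trans_lt hST⟩ ht₀.2 hdu₀ hdv₀ hσ (by positivity)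
          (hac.trans_le (by gcongr)) (haδ.trans (by gcongr)) hmax
    · exact Or.inr ⟨hx₀, ht₀T⟩
  have h1 := abs_ut_le_sSup hT hu.isC3 hbdry
  have h2 : σ * ut T u x₀ t₀ ≤ |ut T u x₀ t₀| :=
    (le_abs_self _).trans_eq (by rw [abs_mul, hσ, one_mul])
  have h3 : a * Real.exp (k * (v x₀ t₀ - u x₀ t₀ - t₀)) ≤ a * Real.exp (2 * k * B) := by
    have : k * (v x₀ t₀ - u x₀ t₀ - t₀) ≤ 2 * k * B := by
      have := mul_le_mul_of_nonneg_left
        (show v x₀ t₀ - u x₀ t₀ - t₀ ≤ 2 * B by linarith [ht₀.1]) hk0.le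
      linarith
    gcongr
  have h4 := hmax x t ht
  have h5 : 0 ≤ a * Real.exp (k * (v x t - u x t - t)) := by positivity
  linarith

end Estimate

end AugHess

open AugHess in
theorem theorem4p1 (n : ℕ) [NeZero n] (hn : 2 ≤ n)
    (M : Type*) [TopologicalSpace M] [T2Space M] [CompactSpace M]
    [ChartedSpace (EuclideanHalfSpace n) M] [IsManifold (𝓡∂ n) ∞ M]
    (g : Metric n M) (𝒜 : FiniteAtlas n M) (T : ℝ) (hT : 0 < T)
    (Γ : Set (Fin (n + 1) → ℝ)) (f : (Fin (n + 1) → ℝ) → ℝ) (hf : IsStructure Γ f)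
    (hgrowth : ∀ C : ℝ, 0 < C → ∃ R : ℝ, 0 < R ∧ C < f (fun _ => R))
    (A : (x : M) → ℝ → Cot n x → Form n x)
    (hA_smooth : IsSmoothTensor T A)
    (hA_symm : ∀ x : M, ∀ t ∈ Icc 0 T, ∀ p v w, A x t p v w = A x t p w v)
    (hA_reg : IsRegular T (fun x t p => -A x t p))
    (K : Set (Fin (n + 1) → ℝ)) (hK : IsCompact K) (hKΓ : K ⊆ Γ) (B : ℝ) :
    ∃ C₄ : ℝ, 0 < C₄ ∧
      ∀ (ψ : (x : M) → ℝ → Cot n x → ℝ) (φ usub u : M → ℝ → ℝ),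
        IsSmoothFun T ψ →
        (∀ x : M, ∀ t ∈ Icc 0 T, ConvexOn ℝ univ (ψ x t)) →
        C2Bound 𝒜 g T B ψ →
        IsSubsolution g T A Γ f ψ φ usub →
        (∀ x ∈ (𝓡∂ n).interior M, ∀ t ∈ Icc 0 T, spec g T A usub x t ∈ K) →
        ParabolicC2Bound g T B usub →
        IsSolution g T A Γ f ψ φ u →
        SpaceC1Bound g T B u →
        ∀ x : M, ∀ t ∈ Icc 0 T,
          |ut T u x t| ≤
            C₄ * (1 + sSup ((fun q : M × ℝ => |ut T u q.1 q.2|) '' parabolicBoundary n M T)) := by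
  obtain ⟨c, hc, δ, hδ, hgain⟩ := hf.exists_gain hK hKΓ (Fin.last n)
  obtain ⟨C, hC0, hC⟩ := exists_lipschitz_tensor g hT hA_smooth (7 * B + 1)
  obtain ⟨k, hk⟩ : ∃ k, k = 2 * C ^ 2 / δ + 1 := ⟨_, rfl⟩
  have hk0 : 0 < k := by rw [hk]; positivity
  obtain ⟨m, hm⟩ : ∃ m, m = k * Real.exp (-(k * (2 * B + T))) := ⟨_, rfl⟩
  have hm0 : 0 < m := by rw [hm]; positivity
  -- `a m` has to exceed `B / c` and `2 C / δ`
  obtain ⟨a, ha⟩ : ∃ a, a = (|B| / c + 2 * C / δ + 1) / m := ⟨_, rfl⟩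
  have ha0 : 0 < a := by rw [ha]; positivity
  have ham : a * k * Real.exp (-(k * (2 * B + T))) = |B| / c + 2 * C / δ + 1 := by
    rw [mul_assoc, ← hm, ha, div_mul_cancel₀ _ hm0.ne']
  have hac : B < a * k * Real.exp (-(k * (2 * B + T))) * c := by
    have h1 : (|B| / c + 2 * C / δ + 1) * c = |B| + (2 * C / δ + 1) * c := by
      field_simp
      ring
    have h2 : 0 < (2 * C / δ + 1) * c := by positivity
    rw [ham, h1]
    linarith [le_abs_self B]
  have haδ : C ≤ a * k * Real.exp (-(k * (2 * B + T))) * (δ / 2) := by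
    have h1 : (|B| / c + 2 * C / δ + 1) * (δ / 2) = C + (|B| / c + 1) * (δ / 2) := by
      field_simp
      ring
    have h2 : 0 ≤ (|B| / c + 1) * (δ / 2) := by positivity
    rw [ham, h1]
    linarith
  refine ⟨1 + a * Real.exp (2 * k * B), by positivity, ?_⟩
  intro ψ φ v u hψ hψ_conv hψ_bdd hv hvK hvB hu huB x
  obtain ⟨P, hP⟩ : ∃ P, P = sSup ((fun q : M × ℝ => |ut T u q.1 q.2|) ''
    parabolicBoundary n M T) := ⟨_, rfl⟩
  have hP0 : 0 ≤ P := hP ▸ Real.sSup_nonneg (by rintro _ ⟨q, -, rfl⟩; exact abs_nonneg _)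
  rw [← hP]
  have hlt : ∀ t ∈ Ico 0 T, |ut T u x t| ≤ (1 + a * Real.exp (2 * k * B)) * (1 + P) := by
    intro t ht
    have key : ∀ σ : ℝ, |σ| = 1 → σ * ut T u x t ≤ a * Real.exp (2 * k * B) + P := fun σ hσ =>
      hP ▸ mul_ut_le hT hf hA_smooth hA_symm hA_reg hc hδ hC0 hk0 ha0 (by linarith) hgain hC hac
        haδ hψ hψ_conv hψ_bdd hv hvK hvB.spaceC1Bound hu huB hσ ht.2 (right_mem_Icc.2 ht.1)
    have h1 := key 1 (by simp)
    have h2 := key (-1) (by simp)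
    have h3 : 0 ≤ a * Real.exp (2 * k * B) * P := by positivity
    rw [abs_le]
    constructor <;> linarith
  -- the estimate at `t = T` follows by continuity
  have hcont : ContinuousOn (fun s => |ut T u x s|) (Icc 0 T) :=
    ((continuousOn_ut (by norm_num) hT hu.isC3).comp (f := fun s => (x, s)) (by fun_prop)
      fun s hs => ⟨mem_univ _, hs⟩).abs
  rw [← closure_Ico hT.ne] at hcont ⊢
  exact fun t ht => le_on_closure hlt hcont continuousOn_const ht
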